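/- Let $Q$ and $V$ be second countable locally compact (Hausdorff) groups with $V$ abelian (written additively), and let $Q$ act continuously on $V$ by automorphisms. Let $\hat V$ be the Pontryagin dual, with pairing written $e^{i\langle\xi,v\rangle}$ and dual action $\langle q^\flat\xi,v\rangle=\langle\xi,q^{-1}v\rangle$. Let $|q|$ denote the modulus of the action of $q$ on $V$, $d(qv)=|q|\,dv$, and $\Delta_Q$ the modular function of $Q$, i.e. $\mu(Aq)=\Delta_Q(q)\mu(A)$ for a left Haar measure $\mu$. Let $\beta\colon Q\times Q\to V$ be a Borel $2$-cocycle, $\beta(q_1,q_2)+\beta(q_1q_2,q_3)=q_1\beta(q_2,q_3)+\beta(q_1,q_2q_3)$, and let $G$ be the corresponding extension of $V$ by $Q$, that is, the set $Q\times V$ with the product Borel structure and the group law $(q_1,v_1)(q_2,v_2)=(q_1q_2,\,v_1+q_1v_2+\beta(q_1,q_2))$. Let $\eta\colon Q\to\hat V$ be a continuous $1$-cocycle, $\eta(q_1q_2)=\eta(q_1)+q_1^\flat\eta(q_2)$, which is essentially bijective, i.e. $\eta$ is an isomorphism of measure classes from $Q$ to $\hat V$ (with their Haar measure classes). Assume that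 $b\colon Q\times Q\to\mathbb T$ is a Borel map such that $$e^{i\langle\eta(q_1^{-1}),\beta(q_2,q_3)\rangle}=\frac{b(q_2,q_3)\,b(q_1,q_2q_3)}{b(q_1,q_2)\,b(q_1q_2,q_3)}\qquad\text{for all } q_1,q_2,q_3\in Q,$$ and put $$\omega\big((q_1,v_1),(q_2,v_2)\big)=e^{-i\langle\eta(q_1^{-1}),v_2\rangle}\,b(q_1,q_2).$$ Fix Haar measures $d\xi$ on $\hat V$, $dv$ on $V$ and a left Haar measure $dq$ on $Q$, normalized so that the Fourier transform $f\mapsto\int_V e^{-i\langle\cdot,v\rangle}f(v)\,dv$ is a unitary from $L^2(V)$ onto $L^2(\hat V)$, and so that $\int_Q f(\eta(q))\,|q|^{-1}dq=\int_{\hat V}f(\xi)\,d\xi$ for all positive Borel functions $f$ on $\hat V$. Equip $G$ with the left Haar measure $dg=|q|^{-1}\,dq\,dv$, $g=(q,v)$. Then the formula $$(\pi(q,v)\varphi)(q_0)=e^{-i\langle\eta(q_0),v\rangle}\,b(q_0^{-1},q)\,\varphi(q^{-1}q_0),\qquad \varphi\in L^2(Q),$$ defines unitary operators $\pi(g)$,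 $g\in G$, on $L^2(Q)$, and $\pi$ is a projective unitary representation of $G$ with $2$-cocycle $\omega$: the map $\omega$ is a Borel $\mathbb T$-valued $2$-cocycle on $G$, all functions $g\mapsto\langle\varphi_1,\pi(g)\varphi_2\rangle$ are Borel, and $\pi(g_1)\pi(g_2)=\omega(g_1,g_2)\,\pi(g_1g_2)$ for all $g_1,g_2\in G$. The representation $\pi$ is irreducible ($L^2(Q)\neq0$ and there are no closed invariant subspaces other than $0$ and $L^2(Q)$) and square-integrable ($\int_G|\langle\varphi_1,\pi(g)\varphi_2\rangle|^2\,dg<\infty$ for some nonzero $\varphi_1,\varphi_2$). Its Duflo--Moore operator, i.e. the unique nonsingular positive self-adjoint operator $D$ on $L^2(Q)$ such that $$\int_G|\langle\varphi_1,\pi(g)\varphi_2\rangle|^2\,dg=\|\varphi_1\|^2\,\|D^{1/2}\varphi_2\|^2\qquad\text{for all }\varphi_1,\varphi_2\in L^2(Q)$$ (where $\|D^{1/2}\varphi_2\|=\infty$ if $\varphi_2$ is not in the domain of $D^{1/2}$, and $0\cdot\infty=0$), exists and is the operator of multiplication by the function $q\mapsto|q|\,\Delta_Q(q)^{-1}$,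 with its maximal domain. -/

import Mathlib

open MeasureTheory Set
open scoped ENNReal NNReal InnerProductSpace

namespace CocycleRep

noncomputable section

/-! ### The dual group, the dual action and cocycles -/

section Dual

variable (V : Type*) [AddCommGroup V] [TopologicalSpace V] [IsTopologicalAddGroup V]

/-- The Pontryagin dual of the (additively written) abelian group `V`, with the topology of
uniform convergence on compact sets. Its group law is written multiplicatively. -/
abbrev Dual : Type _ := PontryaginDual (Multiplicative V)

variable {V}

/-- The duality pairing `e^{i⟨ξ, v⟩}`. -/
def pairing (ξ : Dual V) (v : V) : Circle := ξ (Multiplicative.ofAdd v)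

variable {Q : Type*} [Group Q] [TopologicalSpace Q] [DistribMulAction Q V] [ContinuousSMul Q V]

/-- The automorphism `v ↦ q v` of the topological group `V`. -/
def actHom (q : Q) : Multiplicative V →ₜ* Multiplicative V where
  toMonoidHom := AddMonoidHom.toMultiplicative (DistribSMul.toAddMonoidHom V q)
  continuous_toFun :=
    continuous_ofAdd.comp ((continuous_const_smul q).comp continuous_toAdd)

/-- The dual action `q^♭` of `Q` on the dual group: `(q^♭ ξ)(v) = ξ(q⁻¹ v)`. -/
def dualAct (q : Q) (ξ : Dual V) : Dual V := PontryaginDual.map (actHom q⁻¹) ξ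

end Dual

/-- Continuous `1`-cocycles `η : Q → V̂`, i.e. `η(q₁q₂) = η(q₁) + q₁^♭ η(q₂)`
(the group law of `V̂` being written multiplicatively). -/
structure OneCocycle (Q V : Type*) [Group Q] [TopologicalSpace Q] [AddCommGroup V]
    [TopologicalSpace V] [IsTopologicalAddGroup V] [DistribMulAction Q V]
    [ContinuousSMul Q V] where
  toFun : Q → Dual V
  continuous_toFun : Continuous toFun
  map_mul' : ∀ q₁ q₂ : Q, toFun (q₁ * q₂) = toFun q₁ * dualAct q₁ (toFun q₂)

/-- Borel `2`-cocycles `β : Q × Q → V`. They are not assumed to be normalized. -/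
structure TwoCocycle (Q V : Type*) [Group Q] [MeasurableSpace Q] [AddCommGroup V]
    [MeasurableSpace V] [DistribMulAction Q V] where
  toFun : Q → Q → V
  measurable_toFun : Measurable (Function.uncurry toFun)
  cocycle : ∀ q₁ q₂ q₃ : Q,
    toFun q₁ q₂ + toFun (q₁ * q₂) q₃ = q₁ • toFun q₂ q₃ + toFun q₁ (q₂ * q₃)

instance (Q V : Type*) [Group Q] [TopologicalSpace Q] [AddCommGroup V]
    [TopologicalSpace V] [IsTopologicalAddGroup V] [DistribMulAction Q V]
    [ContinuousSMul Q V] : CoeFun (OneCocycle Q V) (fun _ => Q → Dual V) := ⟨OneCocycle.toFun⟩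

instance (Q V : Type*) [Group Q] [MeasurableSpace Q] [AddCommGroup V]
    [MeasurableSpace V] [DistribMulAction Q V] :
    CoeFun (TwoCocycle Q V) (fun _ => Q → Q → V) := ⟨TwoCocycle.toFun⟩

/-! ### The extension defined by a Borel `2`-cocycle -/

/-- The underlying set `Q × V` of the extension `G` of `V` by `Q` defined by `β`. -/
@[ext]
structure Extension {Q V : Type*} [Group Q] [MeasurableSpace Q] [AddCommGroup V]
    [MeasurableSpace V] [DistribMulAction Q V] (β : TwoCocycle Q V) where
  q : Q
  v : V

namespace Extension

variable {Q V : Type*} [Group Q] [MeasurableSpace Q] [AddCommGroup V]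
  [MeasurableSpace V] [DistribMulAction Q V] {β : TwoCocycle Q V}

/-- `(q₁, v₁)(q₂, v₂) = (q₁ q₂, v₁ + q₁ v₂ + β(q₁, q₂))`. -/
instance : Mul (Extension β) := ⟨fun g h => ⟨g.q * h.q, g.v + g.q • h.v + β g.q h.q⟩⟩

instance : One (Extension β) := ⟨⟨1, -β 1 1⟩⟩

instance : Inv (Extension β) := ⟨fun g => ⟨g.q⁻¹, -(g.q⁻¹ • g.v) - β g.q⁻¹ g.q - β 1 1⟩⟩

@[simp] theorem mul_q (g h : Extension β) : (g * h).q = g.q * h.q := rfl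
@[simp] theorem mul_v (g h : Extension β) : (g * h).v = g.v + g.q • h.v + β g.q h.q := rfl
@[simp] theorem one_q : (1 : Extension β).q = 1 := rfl
@[simp] theorem one_v : (1 : Extension β).v = -β 1 1 := rfl
@[simp] theorem inv_q (g : Extension β) : g⁻¹.q = g.q⁻¹ := rfl
@[simp] theorem inv_v (g : Extension β) :
    g⁻¹.v = -(g.q⁻¹ • g.v) - β g.q⁻¹ g.q - β 1 1 := rfl

instance : Group (Extension β) :=
  Group.ofLeftAxioms
    (by
      intro a b c
      ext
      · simp [mul_assoc]
      · have h := β.cocycle a.q b.q c.q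
        simp only [mul_v, mul_q, smul_add, mul_smul]
        have h' : β a.q b.q = a.q • β b.q c.q + β a.q (b.q * c.q) - β (a.q * b.q) c.q :=
          eq_sub_of_add_eq h
        rw [h']
        abel)
    (by
      intro a
      ext
      · simp
      · have h := β.cocycle 1 1 a.q
        simp only [mul_one, one_mul, one_smul] at h
        have h' : β 1 1 = β 1 a.q := add_right_cancel h
        simp [h'])
    (by
      intro a
      ext
      · simp
      · simp only [mul_v, inv_v, inv_q, one_v]
        abel)

/-- The Borel structure of `G` is that of the product space `Q × V`. -/
instance : MeasurableSpace (Extension β) :=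
  MeasurableSpace.comap (fun g : Extension β => (g.q, g.v)) inferInstance

end Extension

/-! ### Measures -/

/-- `f : X → Y` is a measure class isomorphism from `(X, [μ])` to `(Y, [ν])`: it is Borel and
nonsingular and has, up to null sets, a Borel nonsingular inverse. -/
def IsMeasureClassIso {X Y : Type*} [MeasurableSpace X] [MeasurableSpace Y]
    (μ : Measure X) (ν : Measure Y) (f : X → Y) : Prop :=
  Measure.QuasiMeasurePreserving f μ ν ∧
    ∃ g : Y → X, Measure.QuasiMeasurePreserving g ν μ ∧
      (∀ᵐ x ∂μ, g (f x) = x) ∧ ∀ᵐ y ∂ν, f (g y) = y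

/-- The modular function `Δ_Q`, with the convention `μ(A q) = Δ_Q(q) μ(A)` for a left Haar
measure `μ`. (Mathlib's `modularCharacter` uses the inverse convention
`μ(A q⁻¹) = modularCharacter q * μ(A)`.) -/
def modularFun {Q : Type*} [Group Q] [TopologicalSpace Q] [IsTopologicalGroup Q]
    [LocallyCompactSpace Q] (q : Q) : ℝ≥0 :=
  (Measure.modularCharacter q)⁻¹

section Measures

variable (V : Type*) [AddCommGroup V] [TopologicalSpace V] [IsTopologicalAddGroup V]
  [LocallyCompactSpace V]

/-- The modulus `|q| = |q|_V` of the action of `q` on `V`: `μ(q A) = |q| μ(A)` for a Haar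
measure `μ` on `V`. -/
def modulus {Q : Type*} [Group Q] [DistribMulAction Q V] [ContinuousConstSMul Q V]
    (q : Q) : ℝ≥0 :=
  distribHaarChar V q

variable {V}
variable [MeasurableSpace V]

/-- The Fourier transform `(F f)(ξ) = ∫ e^{-i⟨ξ, v⟩} f(v) dv` of integrable functions. -/
def fourier (μV : Measure V) (f : V → ℂ) (ξ : Dual V) : ℂ :=
  ∫ v, (((pairing ξ v)⁻¹ : Circle) : ℂ) * f v ∂μV

/-- The measures on `V` and on its dual are normalized with respect to each other: the Fourier
transform, given on `L¹ ∩ L²` by the integral formula, is a unitary from `L²(V)` onto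
`L²(V̂)`. -/
def IsDualNormalized [MeasurableSpace (Dual V)] (μV : Measure V) (μD : Measure (Dual V)) :
    Prop :=
  ∃ U : Lp ℂ 2 μV ≃ₗᵢ[ℂ] Lp ℂ 2 μD,
    ∀ f : Lp ℂ 2 μV, Integrable f μV → U f =ᵐ[μD] fourier μV f

/-- The measure on `Q` is normalized by
`∫_Q f(η(q)) |q|⁻¹ dq = ∫_{V̂} f(ξ) dξ` for all positive Borel functions `f`. -/
def IsCocycleNormalized {Q : Type*} [Group Q] [TopologicalSpace Q] [MeasurableSpace Q]
    [DistribMulAction Q V] [ContinuousSMul Q V]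
    [MeasurableSpace (Dual V)] (η : OneCocycle Q V)
    (μQ : Measure Q) (μD : Measure (Dual V)) : Prop :=
  ∀ f : Dual V → ℝ≥0∞, Measurable f →
    ∫⁻ q, f (η q) * ((modulus V q : ℝ≥0) : ℝ≥0∞)⁻¹ ∂μQ = ∫⁻ ξ, f ξ ∂μD

/-- The left Haar measure `d(q, v) = |q|⁻¹ dq dv` on the extension `G`. -/
def extensionHaar {Q : Type*} [Group Q] [TopologicalSpace Q] [MeasurableSpace Q]
    [DistribMulAction Q V] [ContinuousSMul Q V] (β : TwoCocycle Q V)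
    (μQ : Measure Q) (μV : Measure V) : Measure (Extension β) :=
  ((μQ.withDensity fun q => ((modulus V q : ℝ≥0) : ℝ≥0∞)⁻¹).prod μV).map
    fun p : Q × V => (⟨p.1, p.2⟩ : Extension β)

end Measures

/-! ### The cocycles `ψ` and `ω` -/

section Cochains

variable {Q V : Type*} [Group Q] [TopologicalSpace Q] [MeasurableSpace Q] [AddCommGroup V]
  [TopologicalSpace V] [IsTopologicalAddGroup V] [MeasurableSpace V] [DistribMulAction Q V]
  [ContinuousSMul Q V]

/-- `ψ(q₁, q₂, q₃) = e^{i⟨η(q₁⁻¹), β(q₂, q₃)⟩}`. -/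
def psi (η : OneCocycle Q V) (β : TwoCocycle Q V) (q₁ q₂ q₃ : Q) : Circle :=
  pairing (η q₁⁻¹) (β q₂ q₃)

/-- The coboundary of a `2`-cochain:
`(∂b)(q₁, q₂, q₃) = b(q₂, q₃) b(q₁, q₂q₃) / (b(q₁, q₂) b(q₁q₂, q₃))`. -/
def coboundary (b : Q → Q → Circle) (q₁ q₂ q₃ : Q) : Circle :=
  b q₂ q₃ * b q₁ (q₂ * q₃) / (b q₁ q₂ * b (q₁ * q₂) q₃)

/-- `ω_η(g₁, g₂) = e^{i⟨η(q₁⁻¹), v₂⟩}`. -/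
def omegaEta (η : OneCocycle Q V) {β : TwoCocycle Q V} (g₁ g₂ : Extension β) : Circle :=
  pairing (η g₁.q⁻¹) g₂.v

/-- `ω(g₁, g₂) = conj(ω_η(g₁, g₂)) b(q₁, q₂)`. -/
def omega (η : OneCocycle Q V) {β : TwoCocycle Q V} (b : Q → Q → Circle)
    (g₁ g₂ : Extension β) : Circle :=
  (omegaEta η g₁ g₂)⁻¹ * b g₁.q g₂.q

end Cochains

/-! ### Projective unitary representations -/

/-- `ω` is a Borel `𝕋`-valued `2`-cocycle on `G`. -/
def IsCircleTwoCocycle {G : Type*} [Group G] [MeasurableSpace G] (ω : G → G → Circle) : Prop :=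
  Measurable (fun p : G × G => (ω p.1 p.2 : ℂ)) ∧
    ∀ g₁ g₂ g₃, ω g₂ g₃ * ω g₁ (g₂ * g₃) = ω g₁ g₂ * ω (g₁ * g₂) g₃

section Rep

variable {G H : Type*} [NormedAddCommGroup H] [InnerProductSpace ℂ H]

/-- `π` is a projective unitary representation with `2`-cocycle `ω`: `ω` is a Borel cocycle,
`g ↦ π(g)` is Borel (for the weak, equivalently strong, operator topology), and
`π(g₁) π(g₂) = ω(g₁, g₂) π(g₁ g₂)`. -/
def IsProjectiveRep [Group G] [MeasurableSpace G] (ω : G → G → Circle)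
    (π : G → H ≃ₗᵢ[ℂ] H) : Prop :=
  IsCircleTwoCocycle ω ∧
    (∀ x y : H, Measurable fun g => ⟪x, π g y⟫_ℂ) ∧
    ∀ (g₁ g₂ : G) (x : H), π g₁ (π g₂ x) = (ω g₁ g₂ : ℂ) • π (g₁ * g₂) x

/-- There are exactly two closed invariant subspaces, `0` and the whole (nonzero) space. -/
def IsIrreducible (π : G → H ≃ₗᵢ[ℂ] H) : Prop :=
  Nontrivial H ∧ ∀ W : Submodule ℂ H, IsClosed (W : Set H) →
    (∀ g, ∀ x ∈ W, π g x ∈ W) → W = ⊥ ∨ W = ⊤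

/-- Some matrix coefficient of `π` with respect to nonzero vectors is square-integrable. -/
def IsSquareIntegrable [MeasurableSpace G] (μG : Measure G) (π : G → H ≃ₗᵢ[ℂ] H) : Prop :=
  ∃ x y : H, x ≠ 0 ∧ y ≠ 0 ∧ ∫⁻ g, ‖⟪x, π g y⟫_ℂ‖ₑ ^ 2 ∂μG < ∞

variable [CompleteSpace H]

/-- A (possibly unbounded) positive self-adjoint operator. -/
def IsPositiveSelfAdjoint (T : H →ₗ.[ℂ] H) : Prop :=
  IsSelfAdjoint T ∧ ∀ x : T.domain, 0 ≤ (⟪(x : H), T x⟫_ℂ).re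

/-- `R` is the positive self-adjoint square root of `T`: `R` is positive self-adjoint and
`R ∘ R = T`, where `R ∘ R` has the natural domain `{x ∈ Dom R | R x ∈ Dom R}`. -/
def IsPositiveSqrt (R T : H →ₗ.[ℂ] H) : Prop :=
  IsPositiveSelfAdjoint R ∧
    ∀ x z : H, (x, z) ∈ T.graph ↔ ∃ y : H, (x, y) ∈ R.graph ∧ (y, z) ∈ R.graph

open Classical in
/-- `D` is the Duflo--Moore operator of `π` with respect to the Haar measure `μG`: it is positive,
self-adjoint and nonsingular, and
`∫_G |⟨x, π(g) y⟩|² dg = ‖x‖² ‖D^{1/2} y‖²` for all vectors `x` and `y`, where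
`‖D^{1/2} y‖² = ∞` if `y` is not in the domain of `D^{1/2}` (and `0 · ∞ = 0`). -/
def IsDufloMoore [MeasurableSpace G] (μG : Measure G) (π : G → H ≃ₗᵢ[ℂ] H)
    (D : H →ₗ.[ℂ] H) : Prop :=
  IsPositiveSelfAdjoint D ∧ (∀ x : D.domain, D x = 0 → x = 0) ∧
    ∃ R : H →ₗ.[ℂ] H, IsPositiveSqrt R D ∧ ∀ x y : H,
      ∫⁻ g, ‖⟪x, π g y⟫_ℂ‖ₑ ^ 2 ∂μG =
        ‖x‖ₑ ^ 2 * (if h : y ∈ R.domain then ‖R ⟨y, h⟩‖ₑ ^ 2 else ∞)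

end Rep

section MulOp

variable {X : Type*} [MeasurableSpace X] {μ : Measure X} (f : X → ℝ)

theorem mul_add_ae (φ χ : Lp ℂ 2 μ) :
    (fun x => (f x : ℂ) * φ x) + (fun x => (f x : ℂ) * χ x) =ᵐ[μ]
      fun x => (f x : ℂ) * (φ + χ : Lp ℂ 2 μ) x := by
  filter_upwards [Lp.coeFn_add φ χ] with x hx
  rw [hx, Pi.add_apply, Pi.add_apply, mul_add]

theorem mul_smul_ae (c : ℂ) (φ : Lp ℂ 2 μ) :
    c • (fun x => (f x : ℂ) * φ x) =ᵐ[μ] fun x => (f x : ℂ) * (c • φ : Lp ℂ 2 μ) x := by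
  filter_upwards [Lp.coeFn_smul c φ] with x hx
  rw [hx, Pi.smul_apply, Pi.smul_apply, smul_eq_mul, smul_eq_mul]
  ring

variable (μ) in
/-- The maximal domain `{φ ∈ L²(X, μ) | f φ ∈ L²(X, μ)}` of multiplication by `f`. -/
def mulDomain : Submodule ℂ (Lp ℂ 2 μ) where
  carrier := {φ | MemLp (fun x => (f x : ℂ) * φ x) 2 μ}
  zero_mem' := by
    have h := mul_smul_ae f 0 (0 : Lp ℂ 2 μ)
    rw [zero_smul, zero_smul] at h
    exact MemLp.ae_eq h MemLp.zero
  add_mem' := fun {φ χ} hφ hχ => (MemLp.add hφ hχ).ae_eq (mul_add_ae f φ χ)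
  smul_mem' := fun c φ hφ => (MemLp.const_smul hφ c).ae_eq (mul_smul_ae f c φ)

theorem mem_mulDomain (φ : Lp ℂ 2 μ) :
    φ ∈ mulDomain μ f ↔ MemLp (fun x => (f x : ℂ) * φ x) 2 μ := Iff.rfl

/-- The product `f φ` as an element of `L²(X, μ)`. -/
def mulFun (φ : mulDomain μ f) : Lp ℂ 2 μ :=
  ((mem_mulDomain f φ.1).1 φ.2).toLp (fun x => (f x : ℂ) * φ.1 x)

theorem coeFn_mulFun (φ : mulDomain μ f) :
    mulFun f φ =ᵐ[μ] fun x => (f x : ℂ) * φ.1 x :=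
  ((mem_mulDomain f φ.1).1 φ.2).coeFn_toLp

theorem mulFun_add (φ χ : mulDomain μ f) : mulFun f (φ + χ) = mulFun f φ + mulFun f χ := by
  apply Lp.ext
  filter_upwards [coeFn_mulFun f (φ + χ), coeFn_mulFun f φ, coeFn_mulFun f χ,
    Lp.coeFn_add (mulFun f φ) (mulFun f χ), mul_add_ae f φ.1 χ.1] with x h₁ h₂ h₃ h₄ h₅
  rw [h₁, h₄, Pi.add_apply, h₂, h₃]
  exact h₅.symm

theorem mulFun_smul (c : ℂ) (φ : mulDomain μ f) : mulFun f (c • φ) = c • mulFun f φ := by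
  apply Lp.ext
  filter_upwards [coeFn_mulFun f (c • φ), coeFn_mulFun f φ,
    Lp.coeFn_smul c (mulFun f φ), mul_smul_ae f c φ.1] with x h₁ h₂ h₃ h₄
  rw [h₁, h₃, Pi.smul_apply, h₂]
  exact h₄.symm

variable (μ) in
/-- The operator of multiplication by `f` on `L²(X, μ)`, with its maximal domain. -/
def mulOp : Lp ℂ 2 μ →ₗ.[ℂ] Lp ℂ 2 μ where
  domain := mulDomain μ f
  toFun :=
    { toFun := mulFun f
      map_add' := mulFun_add f
      map_smul' := mulFun_smul f }

end MulOp

end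

end CocycleRep

set_option linter.unusedSectionVars false
set_option linter.style.haveILetI false

namespace CocycleRep

/-! ### Topological groups -/

/-! Everything rests on the orthogonality relation `IsCocycleRep.lintegral_inner`. For fixed `q`,
the coefficient `v ↦ ⟨x, π(q,v)y⟩` is the Fourier transform, carried over to `Q` by `η`, of the
integrable function `F(q₀) = b(q₀⁻¹,q) y(q⁻¹q₀) conj(x(q₀))`. Since `η` carries `|q|⁻¹ dq` to `dξ`,
Plancherel gives `∫ |q₀| |F(q₀)|² dq₀` for the integral over `v`, and `q₀ = qs` turns this into `|q|
∫ |s| |y(s)|² |x(qs)|² ds`. The density `|q|⁻¹` of `dg` cancels `|q|`. By Tonelli the `q`-integral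
of `|x(qs)|²` is `Δ_Q(s)⁻¹ ‖x‖²`, which leaves `‖x‖² ∫ |s| Δ_Q(s)⁻¹ |y(s)|² ds`.

As `F` is only known to be in `L¹`, Plancherel is needed with both sides possibly infinite: an
integrable function whose transform is in `L²` must itself be in `L²`
(`memLp_of_memLp_integral_char_mul`). This rests on injectivity of the Fourier transform on `L¹`.

Irreducibility follows because a vector orthogonal to the orbit of some `y ≠ 0` makes the left side
vanish. Square-integrability follows because the weight is finite everywhere, so its form is finite
on a dense subspace. The Duflo–Moore operator is then identified by two facts: multiplication
operators are self-adjoint with the expected square roots, and a positive operator is determined by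
the form of its square root (`IsPositiveSqrt.eq_of_form_eq`). The algebraic part is the relation `ψ
= ∂b` combined with the cocycle identity of `η`. -/

/-- A second countable locally compact Hausdorff group is Polish. -/
theorem polishSpace_of_locallyCompact (Q : Type*) [Group Q] [TopologicalSpace Q]
    [IsTopologicalGroup Q] [T2Space Q] [SecondCountableTopology Q] [LocallyCompactSpace Q] :
    PolishSpace Q := by
  letI : UniformSpace Q := IsTopologicalGroup.rightUniformSpace Q
  haveI : IsRightUniformGroup Q := ⟨rfl⟩
  haveI : CompleteSpace Q := IsRightUniformGroup.completeSpace_of_weaklyLocallyCompactSpace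
  haveI : (uniformity Q).IsCountablyGenerated := by
    rw [uniformity_eq_comap_nhds_one]
    infer_instance
  infer_instance

/-! ### The duality pairing: bilinearity, dual action, joint continuity. -/

section Pairing

variable {V : Type*} [AddCommGroup V] [TopologicalSpace V] [IsTopologicalAddGroup V]

theorem pairing_add (ξ : Dual V) (v w : V) : pairing ξ (v + w) = pairing ξ v * pairing ξ w :=
  map_mul ξ (Multiplicative.ofAdd v) (Multiplicative.ofAdd w)

theorem pairing_mul (ξ ζ : Dual V) (v : V) : pairing (ξ * ζ) v = pairing ξ v * pairing ζ v := rfl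

theorem pairing_dualAct {Q : Type*} [Group Q] [TopologicalSpace Q] [DistribMulAction Q V]
    [ContinuousSMul Q V] (q : Q) (ξ : Dual V) (v : V) :
    pairing (dualAct q ξ) v = pairing ξ (q⁻¹ • v) := rfl

theorem continuous_pairing [LocallyCompactSpace V] :
    Continuous fun p : Dual V × V => pairing p.1 p.2 :=
  (ContinuousEval.continuous_eval (F := Multiplicative V →ₜ* Circle)).comp
    (continuous_fst.prodMk (continuous_ofAdd.comp continuous_snd))

theorem continuous_pairing_left [LocallyCompactSpace V] (v : V) :
    Continuous fun ξ : Dual V => pairing ξ v :=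
  continuous_pairing.comp (Continuous.prodMk_left v)

theorem continuous_pairing_right (ξ : Dual V) : Continuous fun v : V => pairing ξ v :=
  (map_continuous ξ).comp continuous_ofAdd

end Pairing

/-! ### The modulus and the modular function: measurability and change of variables. -/

section Characters

variable (Q V : Type*)
    [Group Q] [TopologicalSpace Q] [IsTopologicalGroup Q] [T2Space Q]
    [SecondCountableTopology Q] [LocallyCompactSpace Q] [MeasurableSpace Q] [BorelSpace Q]
    [AddCommGroup V] [TopologicalSpace V] [IsTopologicalAddGroup V] [T2Space V]
    [SecondCountableTopology V] [LocallyCompactSpace V] [MeasurableSpace V] [BorelSpace V]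
    [DistribMulAction Q V] [ContinuousSMul Q V]

-- For a compact neighbourhood `K` of `0`, `|q| = μ(qK)/μ(K)`, and `μ(qK)` is the integral over `v`
-- of a function jointly Borel in `(q, v)`. The modular character is treated in the same way.
open scoped Pointwise in
theorem measurable_modulus : Measurable fun q : Q => modulus V q := by
  obtain ⟨K, hK, hK1⟩ := exists_compact_mem_nhds (0 : V)
  let μ : Measure V := Measure.addHaar
  have h0 : μ K ≠ 0 := (Measure.measure_pos_of_mem_nhds μ hK1).ne'
  have h1 : μ K ≠ ∞ := hK.measure_ne_top
  have key : Measurable fun q : Q => ((modulus V q : ℝ≥0) : ℝ≥0∞) := by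
    have : (fun q : Q => ((modulus V q : ℝ≥0) : ℝ≥0∞)) =
        fun q => (∫⁻ v, K.indicator 1 (q⁻¹ • v) ∂μ) / μ K := by
      ext q
      rw [modulus, distribHaarChar_eq_div (μ := μ) h0 h1]
      congr 1
      have : (fun v => K.indicator (1 : V → ℝ≥0∞) (q⁻¹ • v)) = (q • K).indicator 1 := by
        ext v
        by_cases h : q⁻¹ • v ∈ K
        · rw [indicator_of_mem h, indicator_of_mem (mem_smul_set_iff_inv_smul_mem.2 h)]; rfl
        · rw [indicator_of_notMem h,
            indicator_of_notMem (mt mem_smul_set_iff_inv_smul_mem.1 h)]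
      rw [this, lintegral_indicator_one (hK.smul q).measurableSet]
    rw [this]
    refine Measurable.div_const ?_ _
    have : Measurable fun p : Q × V => K.indicator (1 : V → ℝ≥0∞) (p.1⁻¹ • p.2) :=
      (measurable_one.indicator hK.measurableSet).comp (by fun_prop)
    exact this.lintegral_prod_right'
  exact (measurable_coe_nnreal_ennreal_iff).1 key

variable {Q}

theorem modulus_pos (q : Q) : 0 < modulus V q := distribHaarChar_pos

theorem modulus_mul (q r : Q) : modulus V (q * r) = modulus V q * modulus V r :=
  map_mul (distribHaarChar V) q r

/-- This is the source of `Δ_Q⁻¹` in the Duflo–Moore weight: in the convention of `modularFun`, the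
factor on the right is `Δ_Q(g)⁻¹`. -/
theorem lintegral_mul_right_eq_modularCharacter (μ : Measure Q) [μ.IsHaarMeasure]
    {f : Q → ℝ≥0∞} (hf : Measurable f) (g : Q) :
    ∫⁻ x, f (x * g) ∂μ = (Measure.modularCharacter g : ℝ≥0) * ∫⁻ x, f x ∂μ := by
  have h : μ.map (· * g) = Measure.modularCharacter g • μ := by
    have h := Measure.isMulLeftInvariant_eq_smul (μ.map (· * g)) μ
    rwa [← Measure.modularCharacterFun_eq_haarScalarFactor] at h
  rw [← lintegral_map hf (measurable_mul_const g), h, lintegral_smul_measure]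
  rfl

variable (Q)

theorem measurable_modularCharacter :
    Measurable fun q : Q => (Measure.modularCharacter q : ℝ≥0) := by
  let μ : Measure Q := Measure.haar
  obtain ⟨K, hK, hK1⟩ := exists_compact_mem_nhds (1 : Q)
  have hK' := measurableSet_closure (s := K)
  have h0 : μ (closure K) ≠ 0 :=
    (Measure.measure_pos_of_mem_nhds μ (Filter.mem_of_superset hK1 subset_closure)).ne'
  have h1 : μ (closure K) ≠ ∞ := hK.closure.measure_ne_top
  have key : Measurable fun q : Q => ((Measure.modularCharacter q : ℝ≥0) : ℝ≥0∞) := by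
    have hi : Measurable ((closure K).indicator (1 : Q → ℝ≥0∞)) := measurable_one.indicator hK'
    have : (fun q : Q => ((Measure.modularCharacter q : ℝ≥0) : ℝ≥0∞)) =
        fun q => (∫⁻ x, (closure K).indicator 1 (x * q) ∂μ) / μ (closure K) := by
      ext q
      rw [lintegral_mul_right_eq_modularCharacter μ hi, lintegral_indicator_one hK',
        ENNReal.mul_div_cancel_right h0 h1]
    rw [this]
    refine Measurable.div_const ?_ _
    have hmul : Measurable fun p : Q × Q => (closure K).indicator (1 : Q → ℝ≥0∞) (p.2 * p.1) :=
      hi.comp (measurable_snd.mul measurable_fst)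
    exact hmul.lintegral_prod_right'
  exact (measurable_coe_nnreal_ennreal_iff).1 key

variable {Q}

theorem modularFun_inv (q : Q) :
    ((modularFun q : ℝ≥0) : ℝ)⁻¹ = (Measure.modularCharacter q : ℝ≥0) := by
  simp [modularFun]

theorem modularCharacter_pos (q : Q) : 0 < (Measure.modularCharacter q : ℝ≥0) :=
  Measure.modularCharacterFun_pos q

end Characters

/-! ### Square roots of unbounded positive operators -/

section Sqrt

variable {H : Type*} [NormedAddCommGroup H] [InnerProductSpace ℂ H] [CompleteSpace H]

/-- `D = R*R` for a positive square root `R` of `D`, in weak form. -/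
theorem IsPositiveSqrt.mem_graph_iff {R D : H →ₗ.[ℂ] H} (h : IsPositiveSqrt R D) (z w : H) :
    (z, w) ∈ D.graph ↔
      ∃ hz : z ∈ R.domain, ∀ y : R.domain, ⟪R y, R ⟨z, hz⟩⟫_ℂ = ⟪(y : H), w⟫_ℂ := by
  have hsa := h.1.1
  have hd := hsa.dense_domain
  have hadj : R.adjoint = R := hsa
  have hf : R.IsFormalAdjoint R := by
    have := LinearPMap.adjoint_isFormalAdjoint hd
    rwa [hadj] at this
  rw [h.2 z w]
  constructor
  · rintro ⟨y, hy, hw⟩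
    rw [LinearPMap.mem_graph_iff] at hy hw
    obtain ⟨⟨z', hz'⟩, rfl, rfl⟩ := hy
    obtain ⟨y', hy', rfl⟩ := hw
    refine ⟨hz', fun y => ?_⟩
    change ⟪R y, R ⟨z', hz'⟩⟫_ℂ = _
    have e : R ⟨z', hz'⟩ = (y' : H) := hy'.symm
    rw [e]
    exact hf y y'
  · rintro ⟨hz, hy⟩
    refine ⟨R ⟨z, hz⟩, LinearPMap.mem_graph R ⟨z, hz⟩, ?_⟩
    have hw : ∀ x : R.domain, ⟪w, (x : H)⟫_ℂ = ⟪R ⟨z, hz⟩, R x⟫_ℂ := fun x => by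
      rw [← inner_conj_symm, ← hy x, inner_conj_symm]
    have hmem := LinearPMap.mem_adjoint_domain_of_exists (T := R) _ ⟨w, hw⟩
    have happ := LinearPMap.adjoint_apply_eq hd ⟨_, hmem⟩ hw
    have hg := LinearPMap.mem_graph R.adjoint ⟨_, hmem⟩
    rw [happ] at hg
    exact (congrArg (fun T : H →ₗ.[ℂ] H => (R ⟨z, hz⟩, w) ∈ T.graph) hadj).mp hg

open Classical in
/-- A positive operator is determined by the quadratic form of its square root. -/
theorem IsPositiveSqrt.eq_of_form_eq {R₁ R₂ D₁ D₂ : H →ₗ.[ℂ] H} (h₁ : IsPositiveSqrt R₁ D₁)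
    (h₂ : IsPositiveSqrt R₂ D₂)
    (h : ∀ y, (if h : y ∈ R₁.domain then ‖R₁ ⟨y, h⟩‖ₑ ^ 2 else ∞) =
      if h : y ∈ R₂.domain then ‖R₂ ⟨y, h⟩‖ₑ ^ 2 else ∞) : D₁ = D₂ := by
  -- The domain is recovered as the set where the form is finite.
  have hdom : ∀ y, y ∈ R₁.domain ↔ y ∈ R₂.domain := by
    intro y
    have hy := h y
    by_cases a : y ∈ R₁.domain <;> by_cases b : y ∈ R₂.domain
    · simp only [a, b]
    · rw [dif_pos a, dif_neg b] at hy
      exact absurd hy (ENNReal.pow_ne_top enorm_ne_top)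
    · rw [dif_neg a, dif_pos b] at hy
      exact absurd hy.symm (ENNReal.pow_ne_top enorm_ne_top)
    · simp only [a, b]
  have hnorm : ∀ y (a : y ∈ R₁.domain) (b : y ∈ R₂.domain), ‖R₁ ⟨y, a⟩‖ = ‖R₂ ⟨y, b⟩‖ := by
    intro y a b
    have hy := h y
    rw [dif_pos a, dif_pos b] at hy
    have := (ENNReal.pow_right_strictMono (n := 2) two_ne_zero).injective hy
    simpa using congrArg ENNReal.toReal this
  have hinner : ∀ (x y : H) (ax : x ∈ R₁.domain) (ay : y ∈ R₁.domain) (bx : x ∈ R₂.domain)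
      (bY : y ∈ R₂.domain), ⟪R₁ ⟨x, ax⟩, R₁ ⟨y, ay⟩⟫_ℂ = ⟪R₂ ⟨x, bx⟩, R₂ ⟨y, bY⟩⟫_ℂ := by
    intro x y ax ay bx bY
    -- Polarization: the four values `c = ±1, ±i` determine the inner product.
    have key : ∀ c : ℂ, ‖R₁ ⟨x, ax⟩ + c • R₁ ⟨y, ay⟩‖ = ‖R₂ ⟨x, bx⟩ + c • R₂ ⟨y, bY⟩‖ := by
      intro c
      rw [← LinearPMap.map_smul, ← LinearPMap.map_add, ← LinearPMap.map_smul,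
        ← LinearPMap.map_add]
      exact hnorm (x + c • y) _ _
    have k1 := key 1
    have k2 := key (-1)
    have k3 := key Complex.I
    have k4 := key (-Complex.I)
    simp only [one_smul, neg_smul, ← sub_eq_add_neg] at k1 k2 k3 k4
    rw [inner_eq_sum_norm_sq_div_four, inner_eq_sum_norm_sq_div_four]
    simp only [RCLike.I_to_complex] at *
    rw [k1, k2, k3, k4]
  apply LinearPMap.eq_of_eq_graph
  ext ⟨z, w⟩
  rw [h₁.mem_graph_iff, h₂.mem_graph_iff]
  constructor
  · rintro ⟨hz, hy⟩
    refine ⟨(hdom z).1 hz, fun y => ?_⟩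
    rw [← hy ⟨y, (hdom y).2 y.2⟩]
    exact (hinner _ _ _ _ _ _).symm
  · rintro ⟨hz, hy⟩
    refine ⟨(hdom z).2 hz, fun y => ?_⟩
    rw [← hy ⟨y, (hdom y).1 y.2⟩]
    exact hinner _ _ _ _ _ _

end Sqrt

/-! ### Multiplication operators -/

section MulOp

variable {X : Type*} [MeasurableSpace X] {μ : Measure X}

theorem enorm_sq_eq_lintegral (φ : Lp ℂ 2 μ) : ‖φ‖ₑ ^ 2 = ∫⁻ x, ‖φ x‖ₑ ^ 2 ∂μ := by
  rw [Lp.enorm_def]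
  have := eLpNorm_nnreal_pow_eq_lintegral (f := φ) (μ := μ) (p := 2) two_ne_zero
  simpa using this

theorem memLp_two_iff_lintegral {f : X → ℂ} (hf : AEStronglyMeasurable f μ) :
    MemLp f 2 μ ↔ ∫⁻ x, ‖f x‖ₑ ^ 2 ∂μ < ∞ := by
  have := eLpNorm_nnreal_pow_eq_lintegral (f := f) (μ := μ) (p := 2) two_ne_zero
  simp only [ENNReal.coe_ofNat, NNReal.coe_ofNat, ENNReal.rpow_ofNat] at this
  rw [← this, MemLp]
  simp [hf, ENNReal.pow_lt_top_iff]

theorem lintegral_enorm_sq_lt_top (φ : Lp ℂ 2 μ) : ∫⁻ x, ‖φ x‖ₑ ^ 2 ∂μ < ∞ :=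
  (memLp_two_iff_lintegral (Lp.aestronglyMeasurable φ)).1 (Lp.memLp φ)

theorem mem_graph_mulOp {f : X → ℝ} {φ χ : Lp ℂ 2 μ} :
    (φ, χ) ∈ (mulOp μ f).graph ↔ χ =ᵐ[μ] fun x => (f x : ℂ) * φ x := by
  rw [LinearPMap.mem_graph_iff]
  constructor
  · rintro ⟨y, rfl, rfl⟩
    exact coeFn_mulFun f y
  · intro h
    have hφ : φ ∈ mulDomain μ f := (Lp.memLp χ).ae_eq h
    exact ⟨⟨φ, hφ⟩, rfl, Lp.ext ((coeFn_mulFun f ⟨φ, hφ⟩).trans h.symm)⟩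

theorem inner_mulFun {f : X → ℝ} (φ : mulDomain μ f) (χ : Lp ℂ 2 μ) :
    ⟪mulFun f φ, χ⟫_ℂ = ∫ x, (f x : ℂ) * (χ x * (starRingEnd ℂ) (φ.1 x)) ∂μ := by
  rw [L2.inner_def]
  refine integral_congr_ae ?_
  filter_upwards [coeFn_mulFun f φ] with x hx
  rw [RCLike.inner_apply, hx, map_mul, Complex.conj_ofReal]
  ring

theorem isFormalAdjoint_mulOp (f : X → ℝ) : (mulOp μ f).IsFormalAdjoint (mulOp μ f) := by
  suffices h : ∀ φ χ : mulDomain μ f, ⟪mulFun f φ, χ.1⟫_ℂ = ⟪φ.1, mulFun f χ⟫_ℂ from h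
  intro φ χ
  rw [inner_mulFun, ← inner_conj_symm, inner_mulFun, ← integral_conj]
  refine integral_congr_ae (Filter.Eventually.of_forall fun x => ?_)
  simp only [map_mul, Complex.conj_ofReal, Complex.conj_conj]
  ring

variable [SigmaFinite μ]

/-- Indicators of finite-measure subsets of `{|f| ≤ n}` lie in the maximal domain, and testing
against them identifies `ψ` with `f χ` on that set; these sets exhaust `X`. The result bounds the
adjoint of `mulOp` by `mulOp` itself, and with `χ = 0` it gives density of the domain. -/
theorem ae_eq_mul_of_inner_eq {f : X → ℝ} (hf : Measurable f) {χ ψ : Lp ℂ 2 μ}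
    (h : ∀ φ : mulDomain μ f, ⟪φ.1, ψ⟫_ℂ = ⟪mulFun f φ, χ⟫_ℂ) :
    ψ =ᵐ[μ] fun x => (f x : ℂ) * χ x := by
  have hS : ∀ n : ℕ, MeasurableSet {x | |f x| ≤ n} := fun n =>
    measurableSet_le (by fun_prop) measurable_const
  have key : ∀ n : ℕ, {x | |f x| ≤ n}.indicator ψ =ᵐ[μ]
      {x | |f x| ≤ n}.indicator fun x => (f x : ℂ) * χ x := by
    intro n
    have hL : MemLp ({x | |f x| ≤ n}.indicator fun x => (f x : ℂ) * χ x) 2 μ := by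
      refine MemLp.mono' ((Lp.memLp χ).norm.const_mul (n : ℝ)) ?_ (Filter.Eventually.of_forall ?_)
      · exact ((Complex.measurable_ofReal.comp hf).aestronglyMeasurable.mul
          (Lp.aestronglyMeasurable χ)).indicator (hS n)
      · intro x
        by_cases hx : |f x| ≤ n
        · rw [indicator_of_mem (by exact hx), norm_mul, Complex.norm_real]
          exact mul_le_mul_of_nonneg_right hx (norm_nonneg _)
        · rw [indicator_of_notMem (by exact hx), norm_zero]
          positivity
    have hW : MemLp ({x | |f x| ≤ n}.indicator ψ) 2 μ := (Lp.memLp ψ).indicator (hS n)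
    have hint : ∀ g : X → ℂ, MemLp g 2 μ → ∀ s, MeasurableSet s → μ s < ∞ →
        IntegrableOn g s μ := by
      intro g hg s _ hs
      haveI : IsFiniteMeasure (μ.restrict s) := ⟨by simpa using hs⟩
      exact (hg.restrict s).integrable one_le_two
    refine ae_eq_of_forall_setIntegral_eq_of_sigmaFinite (hint _ hW) (hint _ hL) ?_
    intro s hs hμs
    have hsn : MeasurableSet (s ∩ {x | |f x| ≤ n}) := hs.inter (hS n)
    have hμsn : μ (s ∩ {x | |f x| ≤ n}) ≠ ∞ := (measure_mono inter_subset_left |>.trans_lt hμs).ne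
    let e : Lp ℂ 2 μ := indicatorConstLp 2 hsn hμsn 1
    have he : e =ᵐ[μ] (s ∩ {x | |f x| ≤ n}).indicator fun _ => 1 := indicatorConstLp_coeFn
    have hdom : e ∈ mulDomain μ f := by
      rw [mem_mulDomain]
      refine MemLp.mono' ((Lp.memLp e).norm.const_mul (n : ℝ)) ?_ ?_
      · exact (Complex.measurable_ofReal.comp hf).aestronglyMeasurable.mul
          (Lp.aestronglyMeasurable e)
      · filter_upwards [he] with x hx
        rw [norm_mul, Complex.norm_real, hx]
        by_cases hx' : x ∈ s ∩ {x | |f x| ≤ n}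
        · exact mul_le_mul_of_nonneg_right hx'.2 (norm_nonneg _)
        · simp [indicator_of_notMem hx']
    have h1 := h ⟨e, hdom⟩
    rw [inner_mulFun] at h1
    change ⟪indicatorConstLp 2 hsn hμsn (1 : ℂ), ψ⟫_ℂ = _ at h1
    rw [L2.inner_indicatorConstLp_one] at h1
    rw [setIntegral_indicator (hS n), setIntegral_indicator (hS n), h1,
      ← integral_indicator hsn]
    refine integral_congr_ae ?_
    filter_upwards [he] with x hx
    rw [hx]
    by_cases hx' : x ∈ s ∩ {x | |f x| ≤ n}
    · simp [indicator_of_mem hx']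
    · simp [indicator_of_notMem hx']
  filter_upwards [ae_all_iff.2 key] with x hx
  obtain ⟨n, hn⟩ := exists_nat_ge |f x|
  have := hx n
  rwa [indicator_of_mem (by exact hn), indicator_of_mem (by exact hn)] at this

theorem dense_mulDomain {f : X → ℝ} (hf : Measurable f) :
    Dense (mulDomain μ f : Set (Lp ℂ 2 μ)) := by
  rw [Submodule.dense_iff_topologicalClosure_eq_top, Submodule.topologicalClosure_eq_top_iff,
    Submodule.eq_bot_iff]
  intro ψ hψ
  rw [Submodule.mem_orthogonal] at hψ
  have := ae_eq_mul_of_inner_eq (μ := μ) hf (χ := 0) (ψ := ψ)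
    fun φ => by rw [hψ φ.1 φ.2, inner_zero_right]
  apply Lp.ext
  filter_upwards [this, Lp.coeFn_zero ℂ 2 μ] with x hx h0
  rw [hx, h0, Pi.zero_apply, mul_zero]

theorem isSelfAdjoint_mulOp {f : X → ℝ} (hf : Measurable f) : IsSelfAdjoint (mulOp μ f) := by
  have hd : Dense ((mulOp μ f).domain : Set (Lp ℂ 2 μ)) := dense_mulDomain hf
  rw [LinearPMap.isSelfAdjoint_def]
  refine le_antisymm ?_ ((isFormalAdjoint_mulOp f).le_adjoint hd)
  rw [← LinearPMap.le_graph_iff]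
  rintro ⟨χ, ψ⟩ h
  rw [LinearPMap.mem_graph_iff] at h
  obtain ⟨y, rfl, rfl⟩ := h
  rw [mem_graph_mulOp]
  refine ae_eq_mul_of_inner_eq hf fun φ => ?_
  exact ((LinearPMap.adjoint_isFormalAdjoint hd).symm φ y).symm

theorem isPositiveSelfAdjoint_mulOp {f : X → ℝ} (hf : Measurable f) (h0 : ∀ x, 0 ≤ f x) :
    IsPositiveSelfAdjoint (mulOp μ f) := by
  suffices h : ∀ φ : mulDomain μ f, 0 ≤ (⟪φ.1, mulFun f φ⟫_ℂ).re from
    ⟨isSelfAdjoint_mulOp hf, h⟩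
  intro φ
  rw [← inner_conj_symm, inner_mulFun, Complex.conj_re]
  have : ∀ x, (f x : ℂ) * (φ.1 x * (starRingEnd ℂ) (φ.1 x)) =
      ((f x * Complex.normSq (φ.1 x) : ℝ) : ℂ) := fun x => by
    rw [Complex.mul_conj]; push_cast; rfl
  simp only [this]
  rw [integral_complex_ofReal, Complex.ofReal_re]
  exact integral_nonneg fun x => mul_nonneg (h0 x) (Complex.normSq_nonneg _)

theorem isPositiveSqrt_mulOp {f : X → ℝ} (hf : Measurable f) (h0 : ∀ x, 0 ≤ f x) :
    IsPositiveSqrt (mulOp μ fun x => √(f x)) (mulOp μ f) := by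
  refine ⟨isPositiveSelfAdjoint_mulOp hf.sqrt fun x => Real.sqrt_nonneg _, fun φ χ => ?_⟩
  have hsq : ∀ x, (√(f x) : ℂ) * (√(f x) : ℂ) = f x := fun x => by
    rw [← Complex.ofReal_mul, Real.mul_self_sqrt (h0 x)]
  simp only [mem_graph_mulOp]
  constructor
  · intro h
    have hm : MemLp (fun x => (√(f x) : ℂ) * φ x) 2 μ := by
      refine MemLp.mono' ((Lp.memLp φ).norm.add (Lp.memLp χ).norm) ?_ ?_
      · exact (Complex.measurable_ofReal.comp hf.sqrt).aestronglyMeasurable.mul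
          (Lp.aestronglyMeasurable φ)
      · filter_upwards [h] with x hx
        -- This bound puts `√f φ` in `L²` as soon as `φ` and `f φ` are, so the domain of `f` lies in
        -- that of `√f`.
        have hs : √(f x) ≤ 1 + f x := by
          nlinarith [Real.sq_sqrt (h0 x), sq_nonneg (√(f x) - 1), Real.sqrt_nonneg (f x)]
        rw [Pi.add_apply, hx, norm_mul, norm_mul, Complex.norm_real, Complex.norm_real,
          Real.norm_of_nonneg (Real.sqrt_nonneg _), Real.norm_of_nonneg (h0 x)]
        nlinarith [norm_nonneg (φ x)]
    refine ⟨hm.toLp _, hm.coeFn_toLp, ?_⟩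
    filter_upwards [h, hm.coeFn_toLp] with x hx h1
    rw [hx, h1, ← mul_assoc, hsq]
  · rintro ⟨ψ, h1, h2⟩
    filter_upwards [h1, h2] with x hx hx'
    rw [hx', hx, ← mul_assoc, hsq]

-- Outside the maximal domain the integral diverges, which matches the value `∞` of the form; the
-- formula therefore needs no domain condition.
open Classical in
theorem form_mulOp_sqrt {f : X → ℝ} (hf : Measurable f) (h0 : ∀ x, 0 ≤ f x) (φ : Lp ℂ 2 μ) :
    (if h : φ ∈ (mulOp μ fun x => √(f x)).domain then
        ‖mulOp μ (fun x => √(f x)) ⟨φ, h⟩‖ₑ ^ 2 else ∞) =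
      ∫⁻ x, ENNReal.ofReal (f x) * ‖φ x‖ₑ ^ 2 ∂μ := by
  have hn : ∀ x, ‖(√(f x) : ℂ) * φ x‖ₑ ^ 2 = ENNReal.ofReal (f x) * ‖φ x‖ₑ ^ 2 := fun x => by
    rw [enorm_mul, mul_pow]
    congr 1
    rw [← ofReal_norm, Complex.norm_real, Real.norm_of_nonneg (Real.sqrt_nonneg _),
      ← ENNReal.ofReal_pow (Real.sqrt_nonneg _), Real.sq_sqrt (h0 x)]
  split_ifs with h
  · change ‖mulFun (fun x => √(f x)) ⟨φ, h⟩‖ₑ ^ 2 = _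
    rw [enorm_sq_eq_lintegral]
    refine lintegral_congr_ae ?_
    filter_upwards [coeFn_mulFun (fun x => √(f x)) ⟨φ, h⟩] with x hx
    rw [hx, hn]
  · have h' : ¬ MemLp (fun x => (√(f x) : ℂ) * φ x) 2 μ := h
    have hm : AEStronglyMeasurable (fun x => (√(f x) : ℂ) * φ x) μ :=
      (Complex.measurable_ofReal.comp hf.sqrt).aestronglyMeasurable.mul (Lp.aestronglyMeasurable φ)
    rw [memLp_two_iff_lintegral hm, not_lt, top_le_iff] at h'
    rw [← h']
    exact lintegral_congr hn

theorem eq_zero_of_mulOp_eq_zero {f : X → ℝ} (h0 : ∀ x, 0 < f x) (φ : (mulOp μ f).domain)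
    (h : mulOp μ f φ = 0) : φ = 0 := by
  have h1 : ((mulFun f φ : Lp ℂ 2 μ) : X → ℂ) =ᵐ[μ] fun x => (f x : ℂ) * φ.1 x :=
    coeFn_mulFun f φ
  rw [show mulFun f φ = 0 from h] at h1
  apply Subtype.ext
  apply Lp.ext
  filter_upwards [h1, Lp.coeFn_zero ℂ 2 μ] with x hx hz
  rw [hz] at hx
  change (φ : Lp ℂ 2 μ) x = (0 : Lp ℂ 2 μ) x
  rw [hz]
  have := hx.symm
  rw [Pi.zero_apply, mul_eq_zero] at this
  exact this.resolve_left (by exact_mod_cast (h0 x).ne')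

end MulOp

/-! ### Injectivity of the Fourier transform on integrable functions -/

section Injectivity

open BoundedContinuousFunction

/-- Finite measures on a Polish space that agree on a set of bounded continuous functions which is
closed under products and conjugation and separates points are equal. -/
theorem measure_ext_of_submonoid {E : Type*} [TopologicalSpace E] [PolishSpace E]
    [MeasurableSpace E] [BorelSpace E] {P P' : Measure E} [IsFiniteMeasure P] [IsFiniteMeasure P']
    (M : Submonoid (E →ᵇ ℂ)) (hstar : ∀ g ∈ M, star g ∈ M)
    (hsep : ∀ x y : E, x ≠ y → ∃ g ∈ M, g x ≠ g y)
    (h : ∀ g ∈ M, ∫ x, g x ∂P = ∫ x, g x ∂P') : P = P' := by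
  have hM : (M : Set (E →ᵇ ℂ)) ∪ star (M : Set (E →ᵇ ℂ)) = M := by
    refine union_eq_left.2 fun g hg => ?_
    have := hstar _ (Set.mem_star.1 hg)
    rwa [star_star] at this
  refine ext_of_forall_mem_subalgebra_integral_eq_of_polish
    (A := StarAlgebra.adjoin ℂ (M : Set (E →ᵇ ℂ))) ?_ ?_
  · intro x y hxy
    obtain ⟨g, hg, hne⟩ := hsep x y hxy
    exact ⟨g, ⟨_, ⟨g, StarAlgebra.subset_adjoin ℂ _ hg, rfl⟩, rfl⟩, hne⟩
  · intro g hg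
    -- As `M` is closed under products and conjugation, the star algebra it generates is its linear
    -- span, and equality of integrals extends by linearity.
    have hg' : g ∈ Submodule.span ℂ (M : Set (E →ᵇ ℂ)) := by
      have h1 : g ∈ (StarAlgebra.adjoin ℂ (M : Set (E →ᵇ ℂ))).toSubalgebra := hg
      rw [StarAlgebra.adjoin_toSubalgebra, hM, ← Subalgebra.mem_toSubmodule,
        Algebra.adjoin_eq_span, Submonoid.closure_eq] at h1
      exact h1
    clear hg
    induction hg' using Submodule.span_induction with
    | mem g hg => exact h g hg
    | zero => simp
    | add f g _ _ hf hg =>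
      simp only [BoundedContinuousFunction.coe_add, Pi.add_apply]
      rw [integral_add (f.integrable P) (g.integrable P),
        integral_add (f.integrable P') (g.integrable P'), hf, hg]
    | smul c f _ hf =>
      simp only [BoundedContinuousFunction.coe_smul]
      rw [integral_smul, integral_smul, hf]

variable {Q V : Type*} [TopologicalSpace Q] [PolishSpace Q] [MeasurableSpace Q] [BorelSpace Q]
  [AddCommGroup V] [TopologicalSpace V] [TopologicalSpace.SeparableSpace V] {χ : Q → V → Circle}

/-- A family of characters of `V` separating almost all points of `Q` defines an injective Fourier
transform on real-valued integrable functions. -/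
theorem ae_eq_zero_of_integral_char_mul_ofReal_eq_zero {ρ : Measure Q}
    (hadd : ∀ q v w, χ q (v + w) = χ q v * χ q w)
    (hcont : ∀ q, Continuous (χ q)) (hcont' : ∀ v, Continuous fun q => χ q v)
    {N : Set Q} (hN : MeasurableSet N) (hNρ : ∀ᵐ q ∂ρ, q ∈ N)
    (hinj : ∀ q ∈ N, ∀ r ∈ N, (∀ v, χ q v = χ r v) → q = r)
    {w : Q → ℝ} (hw : Integrable w ρ) (h : ∀ v, ∫ q, (χ q v : ℂ) * (w q : ℂ) ∂ρ = 0) :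
    w =ᵐ[ρ] 0 := by
  wlog hwm : Measurable w generalizing w
  · have hae := hw.aemeasurable.ae_eq_mk
    have := this (hw.congr hae) (fun v => by
      rw [← h v]
      refine integral_congr_ae ?_
      filter_upwards [hae] with q hq
      rw [hq]) hw.aemeasurable.measurable_mk
    exact hae.trans this
  have hwm' : Measurable fun q => -w q := hwm.neg
  borelize Circle
  haveI : PolishSpace (ℕ → Circle) := {}
  -- Continuous characters are determined by their values on a dense sequence, so `T` is injective
  -- on `N`. Measures are compared on `ℕ → Circle`, where the coordinates separate all points,
  -- rather than on `Q`, where separation is only assumed on `N`.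
  let d := TopologicalSpace.denseSeq V
  let T : Q → (ℕ → Circle) := fun q n => χ q (d n)
  have hTc : Continuous T := continuous_pi fun n => hcont' _
  have hT : Measurable T := hTc.measurable
  have hTinj : InjOn T N := fun q hq r hr hqr => hinj q hq r hr fun v =>
    congrFun ((hcont q).ext_on (TopologicalSpace.denseRange_denseSeq V) (hcont r) (by
      rintro _ ⟨n, rfl⟩
      exact congrFun hqr n)) v
  -- `P` and `P'` are the positive and negative parts of `w ρ`; the hypothesis says that they
  -- integrate every character equally.
  let P := ρ.withDensity fun q => ENNReal.ofReal (w q)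
  let P' := ρ.withDensity fun q => ENNReal.ofReal (-w q)
  have hfin : ∀ u : Q → ℝ, Integrable u ρ → ∫⁻ q, ENNReal.ofReal (u q) ∂ρ ≠ ∞ := fun u hu =>
    ((lintegral_ofReal_le_lintegral_enorm u).trans_lt hu.2).ne
  haveI : IsFiniteMeasure P := isFiniteMeasure_withDensity (hfin w hw)
  haveI : IsFiniteMeasure P' := isFiniteMeasure_withDensity (hfin _ hw.neg)
  have hzero : ∀ q, χ q 0 = 1 := fun q => by
    have := hadd q 0 0
    rw [add_zero] at this
    exact (left_eq_mul.1 this)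
  have hneg : ∀ q v, χ q (-v) = (χ q v)⁻¹ := fun q v => by
    rw [eq_inv_iff_mul_eq_one, ← hadd, neg_add_cancel, hzero]
  -- Functions that pull back along `T` to a character of the family; the coordinate functions are
  -- among them.
  let M : Submonoid ((ℕ → Circle) →ᵇ ℂ) :=
    { carrier := {g | ∃ v, ∀ q, g (T q) = χ q v}
      one_mem' := ⟨0, fun q => by rw [hzero]; rfl⟩
      mul_mem' := by
        rintro f g ⟨v, hv⟩ ⟨u, hu⟩
        exact ⟨v + u, fun q => by
          rw [hadd, Circle.coe_mul, ← hv, ← hu]; rfl⟩ }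
  have hmap : P.map T = P'.map T := by
    haveI := Measure.isFiniteMeasure_map P T
    haveI := Measure.isFiniteMeasure_map P' T
    refine measure_ext_of_submonoid M ?_ ?_ ?_
    · rintro g ⟨v, hv⟩
      exact ⟨-v, fun q => by
        rw [hneg, Circle.coe_inv_eq_conj, ← hv]; rfl⟩
    · intro x y hxy
      obtain ⟨n, hn⟩ := Function.ne_iff.1 hxy
      refine ⟨BoundedContinuousFunction.mkOfBound ⟨fun x => (x n : ℂ), by fun_prop⟩ 2
        fun x y => ?_, ⟨d n, fun q => rfl⟩, fun e => hn (Circle.ext e)⟩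
      refine (dist_le_norm_add_norm _ _).trans ?_
      simp only [ContinuousMap.coe_mk, Circle.norm_coe]
      norm_num
    · rintro g ⟨v, hv⟩
      have hgi : ∀ u : Q → ℝ, Integrable u ρ →
          Integrable (fun q => (ENNReal.ofReal (u q)).toReal • g (T q)) ρ := fun u hu => by
        simp only [ENNReal.toReal_ofReal', Complex.real_smul]
        simp only [mul_comm _ (g _)]
        exact hu.pos_part.ofReal.bdd_mul (g.continuous.comp hTc).aestronglyMeasurable
          (Filter.Eventually.of_forall fun q => g.norm_coe_le_norm _)
      rw [integral_map hT.aemeasurable (g.continuous.aestronglyMeasurable),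
        integral_map hT.aemeasurable (g.continuous.aestronglyMeasurable),
        integral_withDensity_eq_integral_toReal_smul hwm.ennreal_ofReal (by simp),
        integral_withDensity_eq_integral_toReal_smul hwm'.ennreal_ofReal (by simp),
        ← sub_eq_zero, ← integral_sub]
      · rw [← h v]
        refine integral_congr_ae (Filter.Eventually.of_forall fun q => ?_)
        simp only [hv, ENNReal.toReal_ofReal', Complex.real_smul]
        have hq : ((w q : ℝ) : ℂ) = (max (w q) 0 : ℝ) - (max (-w q) 0 : ℝ) := by
          rw [← Complex.ofReal_sub, max_zero_sub_max_neg_zero_eq_self]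
        rw [hq]
        ring
      exacts [hgi w hw, hgi _ hw.neg]
  have hPP : P = P' := by
    ext A hA
    have hNull : ∀ u : Q → ℝ≥0∞, ∀ s t : Set Q, s ∩ N = t ∩ N →
        ρ.withDensity u s = ρ.withDensity u t := by
      intro u s t hst
      have hae : ∀ᵐ q ∂ρ.withDensity u, q ∈ N := (withDensity_absolutelyContinuous ρ u).ae_le hNρ
      refine measure_congr ?_
      filter_upwards [hae] with q hq
      exact propext ⟨fun hs => ((hst ▸ ⟨hs, hq⟩ : q ∈ t ∩ N)).1,
        fun hs => ((hst.symm ▸ ⟨hs, hq⟩ : q ∈ s ∩ N)).1⟩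
    -- Lusin–Souslin: an injective Borel image of a Borel subset of a Polish space is Borel. Hence,
    -- inside `N`, every Borel set is a preimage under `T`, and equality of the image measures
    -- descends to `Q`.
    have hB : MeasurableSet (T '' (A ∩ N)) :=
      (hA.inter hN).image_of_measurable_injOn hT (hTinj.mono inter_subset_right)
    have hset : A ∩ N = (T ⁻¹' (T '' (A ∩ N))) ∩ N := by
      ext q
      refine ⟨fun hq => ⟨⟨q, hq, rfl⟩, hq.2⟩, ?_⟩
      rintro ⟨⟨r, hr, hrq⟩, hq⟩
      rwa [← hTinj hr.2 hq hrq]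
    change ρ.withDensity _ A = ρ.withDensity _ A
    rw [hNull _ _ _ hset, hNull _ _ _ hset]
    have := congrArg (fun m : Measure (ℕ → Circle) => m (T '' (A ∩ N))) hmap
    simpa only [Measure.map_apply hT hB] using this
  replace hPP := (withDensity_eq_iff hwm.ennreal_ofReal.aemeasurable hwm'.ennreal_ofReal.aemeasurable
    (hfin w hw)).1 hPP
  filter_upwards [hPP] with q hq
  rcases le_total 0 (w q) with h0 | h0
  · rw [ENNReal.ofReal_of_nonpos (neg_nonpos.2 h0), ENNReal.ofReal_eq_zero] at hq
    exact le_antisymm hq h0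
  · rw [ENNReal.ofReal_of_nonpos h0, eq_comm, ENNReal.ofReal_eq_zero, neg_nonpos] at hq
    exact le_antisymm h0 hq

/-- Conjugating and replacing `v` by `-v` shows that the hypothesis passes to the conjugate of `W`,
hence to its real and imaginary parts. -/
theorem ae_eq_zero_of_integral_char_mul_eq_zero {ρ : Measure Q}
    (hadd : ∀ q v w, χ q (v + w) = χ q v * χ q w)
    (hcont : ∀ q, Continuous (χ q)) (hcont' : ∀ v, Continuous fun q => χ q v)
    {N : Set Q} (hN : MeasurableSet N) (hNρ : ∀ᵐ q ∂ρ, q ∈ N)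
    (hinj : ∀ q ∈ N, ∀ r ∈ N, (∀ v, χ q v = χ r v) → q = r)
    {W : Q → ℂ} (hW : Integrable W ρ) (h : ∀ v, ∫ q, (χ q v : ℂ) * W q ∂ρ = 0) :
    W =ᵐ[ρ] 0 := by
  have hzero : ∀ q, χ q 0 = 1 := fun q => by
    have := hadd q 0 0
    rw [add_zero] at this
    exact (left_eq_mul.1 this)
  have hneg : ∀ q v, χ q (-v) = (χ q v)⁻¹ := fun q v => by
    rw [eq_inv_iff_mul_eq_one, ← hadd, neg_add_cancel, hzero]
  have hmul : ∀ v, ∀ {F : Q → ℂ}, Integrable F ρ → Integrable (fun q => (χ q v : ℂ) * F q) ρ :=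
    fun v F hF => hF.bdd_mul (c := 1)
      (continuous_subtype_val.comp (hcont' v)).aestronglyMeasurable
      (Filter.Eventually.of_forall fun q => (Circle.norm_coe _).le)
  have hWc : Integrable (fun q => (starRingEnd ℂ) (W q)) ρ := by
    rw [← integrable_norm_iff (Complex.continuous_conj.comp_aestronglyMeasurable hW.1)]
    simpa using hW.norm
  have hc : ∀ v, ∫ q, (χ q v : ℂ) * (starRingEnd ℂ) (W q) ∂ρ = 0 := fun v => by
    have := congrArg (starRingEnd ℂ) (h (-v))
    rw [← integral_conj, map_zero] at this
    rw [← this]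
    refine integral_congr_ae (Filter.Eventually.of_forall fun q => ?_)
    simp only [hneg, Circle.coe_inv_eq_conj, map_mul, Complex.conj_conj]
  have hre := ae_eq_zero_of_integral_char_mul_ofReal_eq_zero hadd hcont hcont' hN hNρ hinj
    hW.re fun v => by
      have e : ∀ q, (χ q v : ℂ) * ((RCLike.re (W q) : ℝ) : ℂ) =
          ((χ q v : ℂ) * W q + (χ q v : ℂ) * (starRingEnd ℂ) (W q)) / 2 := fun q => by
        rw [← mul_add, Complex.add_conj]; simp; ring
      simp only [e]
      rw [integral_div, integral_add (hmul v hW) (hmul v hWc), h, hc]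
      simp
  have him := ae_eq_zero_of_integral_char_mul_ofReal_eq_zero hadd hcont hcont' hN hNρ hinj
    hW.im fun v => by
      have e : ∀ q, (χ q v : ℂ) * ((RCLike.im (W q) : ℝ) : ℂ) =
          ((χ q v : ℂ) * W q - (χ q v : ℂ) * (starRingEnd ℂ) (W q)) / (2 * Complex.I) := fun q => by
        rw [← mul_sub, Complex.sub_conj]
        have := Complex.I_ne_zero
        simp
        field_simp
      simp only [e]
      rw [integral_div, integral_sub (hmul v hW) (hmul v hWc), h, hc]
      simp
  filter_upwards [hre, him] with q h1 h2
  exact Complex.ext h1 h2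

end Injectivity

/-! ### The Plancherel formula for integrable functions -/

section Plancherel

variable {Q V : Type*} [MeasurableSpace Q] [MeasurableSpace V]
  {ρ : Measure Q} {μ : Measure V} [SigmaFinite ρ] [SigmaFinite μ] {χ : Q → V → Circle}

theorem aestronglyMeasurable_char_mul (hχ : Measurable fun p : Q × V => (χ p.1 p.2 : ℂ))
    {H : Q → ℂ} (hH : AEStronglyMeasurable H ρ) :
    AEStronglyMeasurable (fun p : Q × V => (χ p.1 p.2 : ℂ) * H p.1) (ρ.prod μ) :=
  hχ.aestronglyMeasurable.mul hH.comp_fst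

theorem aestronglyMeasurable_integral_char_mul
    (hχ : Measurable fun p : Q × V => (χ p.1 p.2 : ℂ))
    {H : Q → ℂ} (hH : AEStronglyMeasurable H ρ) :
    AEStronglyMeasurable (fun v => ∫ q, (χ q v : ℂ) * H q ∂ρ) μ :=
  (aestronglyMeasurable_char_mul (μ := μ) hχ hH).prod_swap.integral_prod_right'

theorem norm_integral_char_mul_le (H : Q → ℂ) (v : V) :
    ‖∫ q, (χ q v : ℂ) * H q ∂ρ‖ ≤ ∫ q, ‖H q‖ ∂ρ :=
  (norm_integral_le_integral_norm _).trans_eq (by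
    congr 1
    ext q
    rw [norm_mul, (Circle.norm_coe _ : ‖(χ q v : ℂ)‖ = 1), one_mul])

/-- The conjugate of the Fourier transform of the indicator function of `s`. -/
noncomputable def charIntegral (μ : Measure V) (χ : Q → V → Circle) (s : Set V) (q : Q) : ℂ :=
  ∫ v in s, (χ q v : ℂ) ∂μ

theorem norm_charIntegral_le {s : Set V} (q : Q) :
    ‖charIntegral μ χ s q‖ ≤ μ.real s := by
  refine (norm_integral_le_integral_norm _).trans_eq ?_
  rw [integral_congr_ae (Filter.Eventually.of_forall fun v => Circle.norm_coe (χ q v))]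
  simp

theorem stronglyMeasurable_charIntegral (hχ : Measurable fun p : Q × V => (χ p.1 p.2 : ℂ))
    (s : Set V) : StronglyMeasurable (charIntegral μ χ s) :=
  hχ.stronglyMeasurable.integral_prod_right' (ν := μ.restrict s)

theorem integral_charIntegral_mul (hχ : Measurable fun p : Q × V => (χ p.1 p.2 : ℂ))
    {H : Q → ℂ} (hH : Integrable H ρ) {s : Set V} (hμs : μ s ≠ ∞) :
    ∫ q, charIntegral μ χ s q * H q ∂ρ = ∫ v in s, ∫ q, (χ q v : ℂ) * H q ∂ρ ∂μ := by
  haveI : IsFiniteMeasure (μ.restrict s) := ⟨by simpa using hμs.lt_top⟩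
  have hint : Integrable (fun p : Q × V => (χ p.1 p.2 : ℂ) * H p.1) (ρ.prod (μ.restrict s)) :=
    (hH.comp_fst _).bdd_mul (c := 1) hχ.aestronglyMeasurable
      (Filter.Eventually.of_forall fun q => (Circle.norm_coe _).le)
  rw [← integral_integral_swap (f := fun q v => (χ q v : ℂ) * H q) hint]
  simp only [charIntegral, integral_mul_const]

variable {U : Lp ℂ 2 μ ≃ₗᵢ[ℂ] Lp ℂ 2 ρ}

theorem fourier_indicator_ae_eq
    (hU : ∀ f : Lp ℂ 2 μ, Integrable f μ →
      U f =ᵐ[ρ] fun q => ∫ v, (((χ q v)⁻¹ : Circle) : ℂ) * f v ∂μ)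
    {s : Set V} (hs : MeasurableSet s) (hμs : μ s ≠ ∞) :
    U (indicatorConstLp 2 hs hμs 1) =ᵐ[ρ] fun q => (starRingEnd ℂ) (charIntegral μ χ s q) := by
  have he : (indicatorConstLp 2 hs hμs (1 : ℂ) : V → ℂ) =ᵐ[μ] s.indicator fun _ => 1 :=
    indicatorConstLp_coeFn
  have hi : Integrable (indicatorConstLp 2 hs hμs (1 : ℂ)) μ :=
    ((integrable_indicator_iff hs).2 (integrableOn_const hμs)).congr he.symm
  filter_upwards [hU _ hi] with q hq
  rw [hq, charIntegral, ← integral_conj, ← integral_indicator hs]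
  refine integral_congr_ae ?_
  filter_upwards [he] with v hv
  rw [hv]
  by_cases h : v ∈ s
  · simp only [indicator_of_mem h, Circle.coe_inv_eq_conj, mul_one]
  · simp only [indicator_of_notMem h, mul_zero]

/-- Unitarity moves `U.symm` onto the indicator of `s`. Together with `integral_charIntegral_mul`,
it expresses the `L²` and the `L¹` inverse transforms, integrated over `s`, as pairings with the
same function `charIntegral μ χ s`, so the two can be compared. -/
theorem inner_fourier_indicator
    (hU : ∀ f : Lp ℂ 2 μ, Integrable f μ →
      U f =ᵐ[ρ] fun q => ∫ v, (((χ q v)⁻¹ : Circle) : ℂ) * f v ∂μ)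
    {s : Set V} (hs : MeasurableSet s) (hμs : μ s ≠ ∞) (K : Lp ℂ 2 ρ) :
    ∫ v in s, U.symm K v ∂μ = ∫ q, charIntegral μ χ s q * K q ∂ρ := by
  rw [← L2.inner_indicatorConstLp_one hs hμs, ← U.inner_map_map, U.apply_symm_apply, L2.inner_def]
  refine integral_congr_ae ?_
  filter_upwards [fourier_indicator_ae_eq hU hs hμs] with q hq
  rw [RCLike.inner_apply, hq, Complex.conj_conj, mul_comm]

theorem integral_char_mul_ae_eq (hχ : Measurable fun p : Q × V => (χ p.1 p.2 : ℂ))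
    (hU : ∀ f : Lp ℂ 2 μ, Integrable f μ →
      U f =ᵐ[ρ] fun q => ∫ v, (((χ q v)⁻¹ : Circle) : ℂ) * f v ∂μ)
    {H : Q → ℂ} (hH : Integrable H ρ) (hH2 : MemLp H 2 ρ) :
    (fun v => ∫ q, (χ q v : ℂ) * H q ∂ρ) =ᵐ[μ] U.symm hH2.toLp := by
  refine ae_eq_of_forall_setIntegral_eq_of_sigmaFinite ?_ ?_ ?_
  · intro s hs hμs
    haveI : IsFiniteMeasure (μ.restrict s) := ⟨by simpa using hμs⟩
    exact Integrable.of_bound (aestronglyMeasurable_integral_char_mul hχ hH.1) _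
      (Filter.Eventually.of_forall (norm_integral_char_mul_le H))
  · intro s hs hμs
    haveI : IsFiniteMeasure (μ.restrict s) := ⟨by simpa using hμs⟩
    exact ((Lp.memLp _).restrict s).integrable one_le_two
  · intro s hs hμs
    rw [inner_fourier_indicator hU hs hμs.ne, ← integral_charIntegral_mul hχ hH hμs.ne]
    refine integral_congr_ae ?_
    filter_upwards [hH2.coeFn_toLp] with q hq
    rw [hq]

variable [AddCommGroup V] [MeasurableAdd V] [μ.IsAddLeftInvariant]

/-- Translating `s` produces a character factor, so an identity valid for all sets of finite measure
becomes the vanishing of a whole Fourier transform. -/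
theorem charIntegral_preimage_add (hadd : ∀ q v w, χ q (v + w) = χ q v * χ q w)
    {s : Set V} (hs : MeasurableSet s) (v : V) (q : Q) :
    charIntegral μ χ ((fun x => -v + x) ⁻¹' s) q = χ q v * charIntegral μ χ s q := by
  have hm : MeasurableSet ((fun x => -v + x) ⁻¹' s) := measurable_const_add (-v) hs
  rw [charIntegral, charIntegral, ← integral_indicator hm, ← integral_indicator hs,
    ← integral_const_mul, ← integral_add_left_eq_self _ v]
  congr 1
  ext x
  by_cases h : x ∈ s
  · rw [indicator_of_mem (by simpa using h), indicator_of_mem h, hadd, Circle.coe_mul]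
  · rw [indicator_of_notMem (by simpa using h), indicator_of_notMem h, mul_zero]

/-- Let `K` be the `L²` function whose inverse transform is that of `H`. The difference `H - K` need
not be integrable, so injectivity is applied to its products with the functions `charIntegral μ χ
s`, which are integrable. All these products vanish almost everywhere, and it remains to see that
the functions `charIntegral μ χ s` have no common zero set of positive measure. -/
theorem memLp_of_memLp_integral_char_mul (hχ : Measurable fun p : Q × V => (χ p.1 p.2 : ℂ))
    (hadd : ∀ q v w, χ q (v + w) = χ q v * χ q w)
    (hU : ∀ f : Lp ℂ 2 μ, Integrable f μ →
      U f =ᵐ[ρ] fun q => ∫ v, (((χ q v)⁻¹ : Circle) : ℂ) * f v ∂μ)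
    (hinj : ∀ W : Q → ℂ, Integrable W ρ → (∀ v, ∫ q, (χ q v : ℂ) * W q ∂ρ = 0) → W =ᵐ[ρ] 0)
    {H : Q → ℂ} (hH : Integrable H ρ) (hH2 : MemLp (fun v => ∫ q, (χ q v : ℂ) * H q ∂ρ) 2 μ) :
    MemLp H 2 ρ := by
  let K : Lp ℂ 2 ρ := U hH2.toLp
  have hbdd : ∀ s, Integrable (fun q => charIntegral μ χ s q * H q) ρ := fun s =>
    hH.bdd_mul (c := μ.real s) (stronglyMeasurable_charIntegral hχ s).aestronglyMeasurable
      (Filter.Eventually.of_forall fun q => norm_charIntegral_le q)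
  have hKi : ∀ s, MeasurableSet s → μ s ≠ ∞ →
      Integrable (fun q => charIntegral μ χ s q * K q) ρ := fun s hs hμs => by
    have h1 : MemLp (charIntegral μ χ s) 2 ρ := by
      have := Lp.memLp (U (indicatorConstLp 2 hs hμs 1))
      rw [memLp_congr_ae (fourier_indicator_ae_eq hU hs hμs)] at this
      refine (memLp_congr_norm this.1
        (stronglyMeasurable_charIntegral hχ s).aestronglyMeasurable ?_).1 this
      exact Filter.Eventually.of_forall fun q => by simp
    exact h1.integrable_mul (Lp.memLp K)
  have hsub : ∀ s, MeasurableSet s → μ s ≠ ∞ →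
      ∫ q, charIntegral μ χ s q * (H q - K q) ∂ρ = 0 := fun s hs hμs => by
    simp only [mul_sub]
    rw [integral_sub (hbdd s) (hKi s hs hμs), integral_charIntegral_mul hχ hH hμs,
      ← inner_fourier_indicator hU hs hμs, sub_eq_zero, LinearIsometryEquiv.symm_apply_apply]
    refine integral_congr_ae (ae_restrict_of_ae ?_)
    exact hH2.coeFn_toLp.symm
  have hzero : ∀ s, MeasurableSet s → μ s ≠ ∞ →
      (fun q => charIntegral μ χ s q * (H q - K q)) =ᵐ[ρ] 0 := fun s hs hμs => by
    refine hinj _ ?_ fun v => ?_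
    · simp only [mul_sub]
      exact (hbdd s).sub (hKi s hs hμs)
    · have := hsub ((fun x => -v + x) ⁻¹' s) (measurable_const_add (-v) hs)
        (by rwa [measure_preimage_add])
      simpa only [charIntegral_preimage_add hadd hs, mul_assoc] using this
  have hF : AEStronglyMeasurable (fun q => H q - K q) ρ := hH.1.sub (Lp.aestronglyMeasurable K)
  let F := hF.mk
  have hFae := hF.ae_eq_mk
  have hA : MeasurableSet {q | F q ≠ 0} :=
    (hF.stronglyMeasurable_mk.measurable (measurableSet_singleton 0)).compl
  have hρA : ρ {q | F q ≠ 0} = 0 := by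
    -- If `H ≠ K` on a set `t` of finite positive measure, every `charIntegral μ χ s` vanishes
    -- almost everywhere on `t`. Then the inverse transform of the indicator of `t` integrates to
    -- zero over every `s`, contradicting the injectivity of `U.symm`.
    by_contra hne
    obtain ⟨t, ht, htA, h0, hlt⟩ := Measure.exists_subset_measure_lt_top hA (pos_iff_ne_zero.2 hne)
    let k : Lp ℂ 2 ρ := indicatorConstLp 2 ht hlt.ne 1
    have hk0 : (U.symm k : V → ℂ) =ᵐ[μ] (0 : V → ℂ) := by
      refine ae_eq_of_forall_setIntegral_eq_of_sigmaFinite ?_ ?_ ?_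
      · intro s hs hμs
        haveI : IsFiniteMeasure (μ.restrict s) := ⟨by simpa using hμs⟩
        exact ((Lp.memLp _).restrict s).integrable one_le_two
      · intro s _ _
        exact integrableOn_zero
      · intro s hs hμs
        rw [inner_fourier_indicator hU hs hμs.ne]
        simp only [Pi.zero_apply, integral_zero]
        refine integral_eq_zero_of_ae ?_
        filter_upwards [hzero s hs hμs.ne, hFae,
          (indicatorConstLp_coeFn : k =ᵐ[ρ] t.indicator fun _ => (1 : ℂ))] with q h1 h2 h3
        rw [h3]
        by_cases hq : q ∈ t
        · have hne : H q - K q ≠ 0 := by rw [h2]; exact htA hq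
          rw [(mul_eq_zero.1 h1).resolve_right hne, zero_mul, Pi.zero_apply]
        · rw [indicator_of_notMem hq, mul_zero, Pi.zero_apply]
    have hk1 : U.symm k = 0 := Lp.ext (hk0.trans (Lp.coeFn_zero ℂ 2 μ).symm)
    have hk2 : k = 0 := by simpa using hk1
    have hk3 : ‖k‖ = 0 := by rw [hk2, norm_zero]
    rw [norm_indicatorConstLp two_ne_zero ENNReal.ofNat_ne_top] at hk3
    have hpos : 0 < ρ.real t := ENNReal.toReal_pos h0.ne' hlt.ne
    have := Real.rpow_pos_of_pos hpos (1 / ENNReal.toReal 2)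
    simp only [norm_one, one_mul] at hk3
    exact this.ne' hk3
  refine (Lp.memLp K).ae_eq ?_
  have : ∀ᵐ q ∂ρ, F q = 0 := by
    rw [ae_iff]; exact hρA
  filter_upwards [this, hFae] with q h1 h2
  exact (sub_eq_zero.1 (h2.trans h1)).symm

/-- If `H` is in `L²`, this is unitarity of `U`; otherwise the transform is not in `L²` either and
both sides are infinite. -/
theorem lintegral_enorm_integral_char_mul_sq (hχ : Measurable fun p : Q × V => (χ p.1 p.2 : ℂ))
    (hadd : ∀ q v w, χ q (v + w) = χ q v * χ q w)
    (hU : ∀ f : Lp ℂ 2 μ, Integrable f μ →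
      U f =ᵐ[ρ] fun q => ∫ v, (((χ q v)⁻¹ : Circle) : ℂ) * f v ∂μ)
    (hinj : ∀ W : Q → ℂ, Integrable W ρ → (∀ v, ∫ q, (χ q v : ℂ) * W q ∂ρ = 0) → W =ᵐ[ρ] 0)
    {H : Q → ℂ} (hH : Integrable H ρ) :
    ∫⁻ v, ‖∫ q, (χ q v : ℂ) * H q ∂ρ‖ₑ ^ 2 ∂μ = ∫⁻ q, ‖H q‖ₑ ^ 2 ∂ρ := by
  by_cases h : MemLp H 2 ρ
  · have h1 := integral_char_mul_ae_eq hχ hU hH h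
    calc _ = ∫⁻ v, ‖U.symm h.toLp v‖ₑ ^ 2 ∂μ := lintegral_congr_ae (by
          filter_upwards [h1] with v hv
          rw [hv])
      _ = ‖h.toLp‖ₑ ^ 2 := by
          rw [← enorm_sq_eq_lintegral, U.symm.enorm_map]
      _ = _ := by
          rw [enorm_sq_eq_lintegral]
          exact lintegral_congr_ae (by
            filter_upwards [h.coeFn_toLp] with q hq
            rw [hq])
  · have h' := mt (memLp_of_memLp_integral_char_mul hχ hadd hU hinj hH) h
    rw [memLp_two_iff_lintegral (aestronglyMeasurable_integral_char_mul hχ hH.1), not_lt,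
      top_le_iff] at h'
    rw [memLp_two_iff_lintegral hH.1, not_lt, top_le_iff] at h
    rw [h, h']

end Plancherel

/-! ### The Plancherel formula transported to `Q` along `η`. -/

section CocyclePlancherel

variable {Q V : Type*}
    [Group Q] [TopologicalSpace Q] [IsTopologicalGroup Q] [T2Space Q]
    [SecondCountableTopology Q] [LocallyCompactSpace Q] [MeasurableSpace Q] [BorelSpace Q]
    [AddCommGroup V] [TopologicalSpace V] [IsTopologicalAddGroup V] [T2Space V]
    [SecondCountableTopology V] [LocallyCompactSpace V] [MeasurableSpace V] [BorelSpace V]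
    [DistribMulAction Q V] [ContinuousSMul Q V]
    {μQ : Measure Q} [μQ.IsHaarMeasure] {η : OneCocycle Q V}

theorem continuous_pairing_cocycle (η : OneCocycle Q V) :
    Continuous fun p : Q × V => pairing (η p.1) p.2 :=
  continuous_pairing.comp
    ((η.continuous_toFun.comp continuous_fst).prodMk continuous_snd)

theorem measurable_pairing_cocycle (η : OneCocycle Q V) :
    Measurable fun p : Q × V => (pairing (η p.1) p.2 : ℂ) :=
  (continuous_subtype_val.comp (continuous_pairing_cocycle η)).measurable

variable (V) in
theorem measurable_modulus_inv : Measurable fun q : Q => ((modulus V q : ℝ≥0) : ℝ≥0∞)⁻¹ :=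
  (measurable_modulus Q V).coe_nnreal_ennreal.inv

variable (V) in
/-- The measure `|q|⁻¹ dq` on `Q`. -/
noncomputable def modulusMeasure (μQ : Measure Q) : Measure Q :=
  μQ.withDensity fun q => ((modulus V q : ℝ≥0) : ℝ≥0∞)⁻¹

theorem coe_modulus_ne_zero (q : Q) : ((modulus V q : ℝ≥0) : ℝ≥0∞) ≠ 0 :=
  ENNReal.coe_ne_zero.2 (modulus_pos V q).ne'

instance : SigmaFinite (modulusMeasure V μQ) :=
  SigmaFinite.withDensity_of_ne_top (Filter.Eventually.of_forall fun q =>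
    ENNReal.inv_ne_top.2 (coe_modulus_ne_zero q))

theorem modulusMeasure_absolutelyContinuous : modulusMeasure V μQ ≪ μQ :=
  withDensity_absolutelyContinuous _ _

variable {μV : Measure V} [μV.IsAddHaarMeasure]
    [MeasurableSpace (Dual V)] [BorelSpace (Dual V)] {μD : Measure (Dual V)}

theorem measurePreserving_cocycle (hμQ : IsCocycleNormalized η μQ μD) :
    MeasurePreserving η (modulusMeasure V μQ) μD := by
  have hη : Measurable η := η.continuous_toFun.measurable
  refine ⟨hη, Measure.ext fun s hs => ?_⟩
  rw [Measure.map_apply hη hs, modulusMeasure, withDensity_apply _ (hη hs),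
    ← lintegral_indicator_one hs, ← hμQ _ (measurable_one.indicator hs),
    ← lintegral_indicator (hη hs)]
  refine lintegral_congr fun q => ?_
  by_cases h : η q ∈ s
  · rw [indicator_of_mem (by exact h), indicator_of_mem h, Pi.one_apply, one_mul]
  · rw [indicator_of_notMem (by exact h), indicator_of_notMem h, zero_mul]

/-- The Fourier transform, transported to `Q` by an essentially bijective cocycle. -/
theorem exists_fourier_cocycle (hη : IsMeasureClassIso μQ μD η) (hμV : IsDualNormalized μV μD)
    (hμQ : IsCocycleNormalized η μQ μD) :
    ∃ U : Lp ℂ 2 μV ≃ₗᵢ[ℂ] Lp ℂ 2 (modulusMeasure V μQ), ∀ f : Lp ℂ 2 μV, Integrable f μV →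
      U f =ᵐ[modulusMeasure V μQ]
        fun q => ∫ v, (((pairing (η q) v)⁻¹ : Circle) : ℂ) * f v ∂μV := by
  obtain ⟨U, hU⟩ := hμV
  obtain ⟨-, g, hg, hgη, -⟩ := hη
  have hmp := measurePreserving_cocycle hμQ
  have hgη' : g ∘ η =ᵐ[modulusMeasure V μQ] id :=
    modulusMeasure_absolutelyContinuous.ae_le hgη
  have hgmp : MeasurePreserving g μD (modulusMeasure V μQ) := by
    refine ⟨hg.measurable, ?_⟩
    rw [← hmp.map_eq, Measure.map_map hg.measurable hmp.measurable, Measure.map_congr hgη',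
      Measure.map_id]
  -- Pullback along `η` is isometric because `η` preserves measure, and onto because of its
  -- essential inverse `g`.
  let L := Lp.compMeasurePreservingₗᵢ (E := ℂ) (p := 2) ℂ η hmp
  have hL : ∀ φ : Lp ℂ 2 μD, L φ =ᵐ[modulusMeasure V μQ] φ ∘ η := fun φ =>
    Lp.coeFn_compMeasurePreserving φ hmp
  have hsurj : Function.Surjective L := fun φ => by
    refine ⟨Lp.compMeasurePreserving g hgmp φ, Lp.ext ?_⟩
    have h1 := hmp.quasiMeasurePreserving.ae_eq_comp (Lp.coeFn_compMeasurePreserving φ hgmp)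
    filter_upwards [hL (Lp.compMeasurePreserving g hgmp φ), h1, hgη'] with q h1 h2 h3
    rw [h1, h2]
    exact congrArg φ h3
  refine ⟨U.trans (LinearIsometryEquiv.ofSurjective L hsurj), fun f hf => ?_⟩
  have h1 := hmp.quasiMeasurePreserving.ae_eq_comp (hU f hf)
  filter_upwards [hL (U f), h1] with q h2 h3
  exact h2.trans h3

theorem ae_eq_zero_of_integral_pairing_cocycle_eq_zero (hη : IsMeasureClassIso μQ μD η)
    {W : Q → ℂ} (hW : Integrable W (modulusMeasure V μQ))
    (h : ∀ v, ∫ q, (pairing (η q) v : ℂ) * W q ∂modulusMeasure V μQ = 0) :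
    W =ᵐ[modulusMeasure V μQ] 0 := by
  obtain ⟨-, g, hg, hgη, -⟩ := hη
  haveI := polishSpace_of_locallyCompact Q
  have hηm : Measurable η := η.continuous_toFun.measurable
  -- The set where `g` inverts `η` is Borel and conull, and `η` is injective on it.
  refine ae_eq_zero_of_integral_char_mul_eq_zero (χ := fun q v => pairing (η q) v)
    (N := {q | g (η q) = q}) (fun q => pairing_add _) (fun q => continuous_pairing_right _)
    (fun v => (continuous_pairing_left v).comp η.continuous_toFun)
    (measurableSet_eq_fun (hg.measurable.comp hηm) measurable_id)
    (modulusMeasure_absolutelyContinuous.ae_le hgη) ?_ hW h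
  intro q hq r hr hqr
  have : η q = η r := PontryaginDual.ext fun v => hqr v.toAdd
  rw [← show g (η q) = q from hq, this]
  exact hr

/-- The Plancherel formula for the Fourier transform transported to `Q`. -/
theorem lintegral_enorm_integral_pairing_cocycle_sq (hη : IsMeasureClassIso μQ μD η)
    (hμV : IsDualNormalized μV μD) (hμQ : IsCocycleNormalized η μQ μD)
    {F : Q → ℂ} (hF : Integrable F μQ) :
    ∫⁻ v, ‖∫ q, (((pairing (η q) v)⁻¹ : Circle) : ℂ) * F q ∂μQ‖ₑ ^ 2 ∂μV =
      ∫⁻ q, ((modulus V q : ℝ≥0) : ℝ≥0∞) * ‖F q‖ₑ ^ 2 ∂μQ := by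
  obtain ⟨U, hU⟩ := exists_fourier_cocycle hη hμV hμQ
  -- The factor `|q|` compensates for passing from `dq` to `|q|⁻¹ dq`, and conjugation turns
  -- `e^{-i⟨η(q),v⟩}` into `e^{i⟨η(q),v⟩}`.
  let H : Q → ℂ := fun q => (modulus V q : ℝ) * (starRingEnd ℂ) (F q)
  have hm := measurable_modulus_inv (Q := Q) V
  have hlt : ∀ᵐ q ∂μQ, ((modulus V q : ℝ≥0) : ℝ≥0∞)⁻¹ < ∞ :=
    Filter.Eventually.of_forall fun q => (ENNReal.inv_ne_top.2 (coe_modulus_ne_zero q)).lt_top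
  have hcancel : ∀ (q : Q) (z : ℂ), (((modulus V q : ℝ≥0) : ℝ≥0∞)⁻¹).toReal •
      (((modulus V q : ℝ) : ℂ) * z) = z := fun q z => by
    have : ((modulus V q : ℝ) : ℂ) ≠ 0 := by exact_mod_cast (modulus_pos V q).ne'
    rw [ENNReal.toReal_inv, ENNReal.coe_toReal, Complex.real_smul, Complex.ofReal_inv,
      inv_mul_cancel_left₀ this]
  have hFc : Integrable (fun q => (starRingEnd ℂ) (F q)) μQ := by
    rw [← integrable_norm_iff (Complex.continuous_conj.comp_aestronglyMeasurable hF.1)]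
    simpa using hF.norm
  have hH : Integrable H (modulusMeasure V μQ) := by
    rw [modulusMeasure, integrable_withDensity_iff_integrable_smul' hm hlt]
    exact hFc.congr (Filter.Eventually.of_forall fun q => (hcancel q _).symm)
  have key := lintegral_enorm_integral_char_mul_sq (χ := fun q v => pairing (η q) v)
    (measurable_pairing_cocycle η) (fun q => pairing_add _) hU
    (fun W => ae_eq_zero_of_integral_pairing_cocycle_eq_zero hη) hH
  have hleft : ∀ v, ‖∫ q, (pairing (η q) v : ℂ) * H q ∂modulusMeasure V μQ‖ₑ =
      ‖∫ q, (((pairing (η q) v)⁻¹ : Circle) : ℂ) * F q ∂μQ‖ₑ := fun v => by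
    rw [modulusMeasure, integral_withDensity_eq_integral_toReal_smul hm hlt,
      ← RCLike.enorm_conj (∫ q, (((pairing (η q) v)⁻¹ : Circle) : ℂ) * F q ∂μQ), ← integral_conj]
    congr 2
    ext q
    rw [mul_left_comm, hcancel, map_mul, Circle.coe_inv_eq_conj, Complex.conj_conj]
  have hHm : AEMeasurable (fun q => ‖H q‖ₑ ^ 2) μQ := by
    have : AEStronglyMeasurable H μQ :=
      (Complex.measurable_ofReal.comp
        (measurable_modulus Q V).coe_nnreal_real).aestronglyMeasurable.mul hFc.1
    exact this.enorm.pow_const 2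
  simp only [hleft] at key
  rw [key, modulusMeasure, lintegral_withDensity_eq_lintegral_mul₀ hm.aemeasurable hHm]
  refine lintegral_congr fun q => ?_
  have h1 : ‖H q‖ₑ = ((modulus V q : ℝ≥0) : ℝ≥0∞) * ‖F q‖ₑ := by
    rw [enorm_mul, RCLike.enorm_conj]
    congr 1
    rw [← ofReal_norm, Complex.norm_real, Real.norm_of_nonneg (NNReal.coe_nonneg _),
      ENNReal.ofReal_coe_nnreal]
  rw [Pi.mul_apply, h1, mul_pow, sq ((modulus V q : ℝ≥0) : ℝ≥0∞), mul_assoc,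
    ENNReal.inv_mul_cancel_left (coe_modulus_ne_zero q) ENNReal.coe_ne_top]

end CocyclePlancherel

/-! ### Weighted translations on `L²(Q)` -/

section Translation

variable {Q : Type*} [Group Q] [MeasurableSpace Q] [MeasurableMul₂ Q] {μ : Measure Q}
  [μ.IsMulLeftInvariant]

theorem memLp_weightedTranslation {u : Q → ℂ} (hu : Measurable u) (hu1 : ∀ x, ‖u x‖ = 1) (q : Q)
    {φ : Q → ℂ} (hφ : MemLp φ 2 μ) : MemLp (fun x => u x * φ (q * x)) 2 μ := by
  have h := hφ.comp_measurePreserving (measurePreserving_mul_left μ q)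
  refine (memLp_congr_norm h.1 (hu.aestronglyMeasurable.mul h.1) ?_).1 h
  exact Filter.Eventually.of_forall fun x => by
    change ‖φ (q * x)‖ = ‖u x * φ (q * x)‖
    rw [norm_mul, hu1, one_mul]

theorem exists_linearIsometry_weightedTranslation {u : Q → ℂ} (hu : Measurable u)
    (hu1 : ∀ x, ‖u x‖ = 1) (q : Q) :
    ∃ T : Lp ℂ 2 μ →ₗᵢ[ℂ] Lp ℂ 2 μ, ∀ φ, T φ =ᵐ[μ] fun x => u x * φ (q * x) := by
  have hmp := measurePreserving_mul_left μ q
  have hm := fun φ : Lp ℂ 2 μ => memLp_weightedTranslation hu hu1 q (Lp.memLp φ)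
  have hcomp : ∀ {f g : Q → ℂ}, f =ᵐ[μ] g → ∀ᵐ x ∂μ, f (q * x) = g (q * x) := fun h =>
    hmp.quasiMeasurePreserving.ae_eq_comp h
  let T : Lp ℂ 2 μ →ₗ[ℂ] Lp ℂ 2 μ :=
    { toFun := fun φ => (hm φ).toLp
      map_add' := fun φ ψ => by
        apply Lp.ext
        filter_upwards [(hm (φ + ψ)).coeFn_toLp, (hm φ).coeFn_toLp, (hm ψ).coeFn_toLp,
          Lp.coeFn_add (hm φ).toLp (hm ψ).toLp, hcomp (Lp.coeFn_add φ ψ)] with x h1 h2 h3 h4 h5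
        rw [h1, h4, Pi.add_apply, h2, h3, h5, Pi.add_apply, mul_add]
      map_smul' := fun c φ => by
        apply Lp.ext
        filter_upwards [(hm (c • φ)).coeFn_toLp, (hm φ).coeFn_toLp,
          Lp.coeFn_smul c (hm φ).toLp, hcomp (Lp.coeFn_smul c φ)] with x h1 h2 h3 h4
        rw [h1, RingHom.id_apply, h3, Pi.smul_apply, h2, h4, Pi.smul_apply, smul_eq_mul,
          smul_eq_mul, mul_left_comm] }
  refine ⟨⟨T, fun φ => ?_⟩, fun φ => (hm φ).coeFn_toLp⟩
  change ‖(hm φ).toLp‖ = ‖φ‖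
  rw [Lp.norm_toLp, Lp.norm_def, ← eLpNorm_comp_measurePreserving (Lp.aestronglyMeasurable φ) hmp]
  congr 1
  refine eLpNorm_congr_norm_ae (Filter.Eventually.of_forall fun x => ?_)
  rw [norm_mul, hu1, one_mul]
  rfl

theorem exists_linearIsometryEquiv_weightedTranslation {u : Q → ℂ} (hu : Measurable u)
    (hu1 : ∀ x, ‖u x‖ = 1) (q : Q) :
    ∃ T : Lp ℂ 2 μ ≃ₗᵢ[ℂ] Lp ℂ 2 μ, ∀ φ, T φ =ᵐ[μ] fun x => u x * φ (q * x) := by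
  obtain ⟨T, hT⟩ := exists_linearIsometry_weightedTranslation (μ := μ) hu hu1 q
  obtain ⟨S, hS⟩ := exists_linearIsometry_weightedTranslation (μ := μ)
    (u := fun x => (u (q⁻¹ * x))⁻¹) (hu.comp (measurable_const_mul _)).inv
    (fun x => by rw [norm_inv, hu1, inv_one]) q⁻¹
  refine ⟨LinearIsometryEquiv.ofSurjective T fun φ => ⟨S φ, Lp.ext ?_⟩, hT⟩
  have h := (measurePreserving_mul_left μ q).quasiMeasurePreserving.ae_eq_comp (hS φ)
  filter_upwards [hT (S φ), h] with x h1 h2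
  have hne : u x ≠ 0 := fun h0 => by simpa [h0] using hu1 x
  rw [h1]
  simp only [Function.comp_apply] at h2
  rw [h2, inv_mul_cancel_left, mul_inv_cancel_left₀ hne]

end Translation

/-! ### The projective representation -/

namespace Extension

variable {Q V : Type*} [Group Q] [MeasurableSpace Q] [AddCommGroup V]
  [MeasurableSpace V] [DistribMulAction Q V] {β : TwoCocycle Q V}

theorem measurable_toProd : Measurable fun g : Extension β => (g.q, g.v) :=
  comap_measurable _

theorem measurable_q : Measurable fun g : Extension β => g.q := measurable_toProd.fst

theorem measurable_v : Measurable fun g : Extension β => g.v := measurable_toProd.snd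

theorem measurable_mk : Measurable fun p : Q × V => (⟨p.1, p.2⟩ : Extension β) := by
  rintro _ ⟨s, hs, rfl⟩
  exact hs

end Extension

section Rep

variable {Q V : Type*}
    [Group Q] [TopologicalSpace Q] [IsTopologicalGroup Q] [T2Space Q]
    [SecondCountableTopology Q] [LocallyCompactSpace Q] [MeasurableSpace Q] [BorelSpace Q]
    [AddCommGroup V] [TopologicalSpace V] [IsTopologicalAddGroup V] [T2Space V]
    [SecondCountableTopology V] [LocallyCompactSpace V] [MeasurableSpace V] [BorelSpace V]
    [DistribMulAction Q V] [ContinuousSMul Q V]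
    {μQ : Measure Q} [μQ.IsHaarMeasure]
    {η : OneCocycle Q V} {β : TwoCocycle Q V} {b : Q → Q → Circle}

/-- The defining formula of the representation `π`. -/
def IsCocycleRep (η : OneCocycle Q V) (b : Q → Q → Circle)
    (π : Extension β → (Lp ℂ 2 μQ ≃ₗᵢ[ℂ] Lp ℂ 2 μQ)) : Prop :=
  ∀ (g : Extension β) (φ : Lp ℂ 2 μQ), ∀ᵐ q₀ ∂μQ,
    π g φ q₀ =
      (((pairing (η q₀) g.v)⁻¹ : Circle) : ℂ) * (b q₀⁻¹ g.q : ℂ) * φ (g.q⁻¹ * q₀)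

theorem exists_isCocycleRep (η : OneCocycle Q V) (β : TwoCocycle Q V)
    (hb : Measurable fun p : Q × Q => (b p.1 p.2 : ℂ)) :
    ∃ π : Extension β → (Lp ℂ 2 μQ ≃ₗᵢ[ℂ] Lp ℂ 2 μQ), IsCocycleRep η b π := by
  have h : ∀ g : Extension β, ∃ T : Lp ℂ 2 μQ ≃ₗᵢ[ℂ] Lp ℂ 2 μQ, ∀ φ : Lp ℂ 2 μQ,
      ∀ᵐ q₀ ∂μQ, T φ q₀ =
        (((pairing (η q₀) g.v)⁻¹ : Circle) : ℂ) * (b q₀⁻¹ g.q : ℂ) * φ (g.q⁻¹ * q₀) := fun g => by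
    refine exists_linearIsometryEquiv_weightedTranslation ?_ (fun q₀ => ?_) g.q⁻¹
    · refine Measurable.mul ?_ (hb.comp (measurable_inv.prodMk measurable_const))
      simp only [Circle.coe_inv]
      exact ((measurable_pairing_cocycle η).comp (measurable_id.prodMk measurable_const)).inv
    · rw [← Circle.coe_mul]
      exact Circle.norm_coe _
  choose π hπ using h
  exact ⟨π, hπ⟩

/-- The cocycle identity of `η` enters the argument only through this formula. -/
theorem pairing_cocycle_inv_mul (q r : Q) (v : V) :
    pairing (η (q⁻¹ * r)) v = pairing (η q⁻¹) v * pairing (η r) (q • v) := by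
  have h := η.map_mul' q⁻¹ r
  rw [h, pairing_mul, pairing_dualAct, inv_inv]

theorem omega_cocycle (hψ : ∀ q₁ q₂ q₃ : Q, psi η β q₁ q₂ q₃ = coboundary b q₁ q₂ q₃)
    (g₁ g₂ g₃ : Extension β) :
    omega η b g₂ g₃ * omega η b g₁ (g₂ * g₃) = omega η b g₁ g₂ * omega η b (g₁ * g₂) g₃ := by
  have h := hψ g₁.q g₂.q g₃.q
  simp only [psi, coboundary] at h
  simp only [omega, omegaEta, Extension.mul_q, Extension.mul_v, mul_inv_rev,
    pairing_cocycle_inv_mul, pairing_add, h]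
  apply Additive.ofMul.injective
  simp only [ofMul_mul, ofMul_inv, ofMul_div]
  abel

theorem isCircleTwoCocycle_omega (hb : Measurable fun p : Q × Q => (b p.1 p.2 : ℂ))
    (hψ : ∀ q₁ q₂ q₃ : Q, psi η β q₁ q₂ q₃ = coboundary b q₁ q₂ q₃) :
    IsCircleTwoCocycle (omega η b : Extension β → Extension β → Circle) := by
  refine ⟨?_, omega_cocycle hψ⟩
  simp only [omega, omegaEta, Circle.coe_mul, Circle.coe_inv]
  refine Measurable.mul ?_ (hb.comp ((Extension.measurable_q.comp measurable_fst).prodMk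
    (Extension.measurable_q.comp measurable_snd)))
  exact ((measurable_pairing_cocycle η).comp
    ((Extension.measurable_q.comp measurable_fst).inv.prodMk
      (Extension.measurable_v.comp measurable_snd))).inv

/-- The weight of `π(g)` at `q₀` is `ω(k, g)` for any `k` with first component `q₀⁻¹`, so this is
the cocycle identity of `ω` at `(k, g₁, g₂)`. -/
theorem weight_mul_weight (hψ : ∀ q₁ q₂ q₃ : Q, psi η β q₁ q₂ q₃ = coboundary b q₁ q₂ q₃)
    (g₁ g₂ : Extension β) (q₀ : Q) :
    (pairing (η q₀) g₁.v)⁻¹ * b q₀⁻¹ g₁.q *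
        ((pairing (η (g₁.q⁻¹ * q₀)) g₂.v)⁻¹ * b (g₁.q⁻¹ * q₀)⁻¹ g₂.q) =
      omega η b g₁ g₂ * ((pairing (η q₀) (g₁ * g₂).v)⁻¹ * b q₀⁻¹ (g₁ * g₂).q) := by
  have h := hψ q₀⁻¹ g₁.q g₂.q
  simp only [psi, coboundary, inv_inv] at h
  simp only [omega, omegaEta, Extension.mul_q, Extension.mul_v, mul_inv_rev, inv_inv,
    pairing_cocycle_inv_mul, pairing_add, h]
  apply Additive.ofMul.injective
  simp only [ofMul_mul, ofMul_inv, ofMul_div]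
  abel

variable {π : Extension β → (Lp ℂ 2 μQ ≃ₗᵢ[ℂ] Lp ℂ 2 μQ)}

theorem IsCocycleRep.apply_apply (hπ : IsCocycleRep η b π)
    (hψ : ∀ q₁ q₂ q₃ : Q, psi η β q₁ q₂ q₃ = coboundary b q₁ q₂ q₃)
    (g₁ g₂ : Extension β) (φ : Lp ℂ 2 μQ) :
    π g₁ (π g₂ φ) = (omega η b g₁ g₂ : ℂ) • π (g₁ * g₂) φ := by
  apply Lp.ext
  have h2 : ∀ᵐ q₀ ∂μQ, π g₂ φ (g₁.q⁻¹ * q₀) =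
      (((pairing (η (g₁.q⁻¹ * q₀)) g₂.v)⁻¹ : Circle) : ℂ) * (b (g₁.q⁻¹ * q₀)⁻¹ g₂.q : ℂ) *
        φ (g₂.q⁻¹ * (g₁.q⁻¹ * q₀)) :=
    (measurePreserving_mul_left μQ g₁.q⁻¹).quasiMeasurePreserving.ae (hπ g₂ φ)
  filter_upwards [hπ g₁ (π g₂ φ), h2, hπ (g₁ * g₂) φ,
    Lp.coeFn_smul (omega η b g₁ g₂ : ℂ) (π (g₁ * g₂) φ)] with q₀ h1 h2 h3 h4
  have hq : (g₁ * g₂).q⁻¹ * q₀ = g₂.q⁻¹ * (g₁.q⁻¹ * q₀) := by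
    rw [Extension.mul_q, mul_inv_rev, mul_assoc]
  rw [h1, h2, h4, Pi.smul_apply, h3, smul_eq_mul, hq]
  have hc := congrArg (fun z : Circle => (z : ℂ)) (weight_mul_weight hψ g₁ g₂ q₀)
  simp only [Circle.coe_mul] at hc
  linear_combination φ (g₂.q⁻¹ * (g₁.q⁻¹ * q₀)) * hc

theorem IsCocycleRep.inner_eq (hπ : IsCocycleRep η b π) (x y : Lp ℂ 2 μQ) (g : Extension β) :
    ⟪x, π g y⟫_ℂ = ∫ q₀, (((pairing (η q₀) g.v)⁻¹ : Circle) : ℂ) *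
      ((b q₀⁻¹ g.q : ℂ) * y (g.q⁻¹ * q₀) * (starRingEnd ℂ) (x q₀)) ∂μQ := by
  rw [L2.inner_def]
  refine integral_congr_ae ?_
  filter_upwards [hπ g y] with q₀ h
  rw [RCLike.inner_apply, h]
  ring

theorem IsCocycleRep.measurable_inner (hπ : IsCocycleRep η b π)
    (hb : Measurable fun p : Q × Q => (b p.1 p.2 : ℂ)) (x y : Lp ℂ 2 μQ) :
    Measurable fun g => ⟪x, π g y⟫_ℂ := by
  simp only [hπ.inner_eq]
  have hx : Measurable x := (Lp.stronglyMeasurable x).measurable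
  have hy : Measurable y := (Lp.stronglyMeasurable y).measurable
  have hq : Measurable fun p : Extension β × Q => p.1.q :=
    Extension.measurable_q.comp measurable_fst
  have hv : Measurable fun p : Extension β × Q => p.1.v :=
    Extension.measurable_v.comp measurable_fst
  have h : Measurable fun p : Extension β × Q =>
      (((pairing (η p.2) p.1.v)⁻¹ : Circle) : ℂ) *
        ((b p.2⁻¹ p.1.q : ℂ) * y (p.1.q⁻¹ * p.2) * (starRingEnd ℂ) (x p.2)) := by
    simp only [Circle.coe_inv]
    refine ((measurable_pairing_cocycle η).comp (measurable_snd.prodMk hv)).inv.mul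
      (((hb.comp (measurable_snd.inv.prodMk hq)).mul
        (hy.comp (hq.inv.mul measurable_snd))).mul ?_)
    exact Complex.continuous_conj.measurable.comp (hx.comp measurable_snd)
  exact (h.stronglyMeasurable.integral_prod_right' (ν := μQ)).measurable

theorem IsCocycleRep.isProjectiveRep (hπ : IsCocycleRep η b π)
    (hb : Measurable fun p : Q × Q => (b p.1 p.2 : ℂ))
    (hψ : ∀ q₁ q₂ q₃ : Q, psi η β q₁ q₂ q₃ = coboundary b q₁ q₂ q₃) :
    IsProjectiveRep (omega η b) π :=
  ⟨isCircleTwoCocycle_omega hb hψ, hπ.measurable_inner hb, hπ.apply_apply hψ⟩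

theorem nontrivial_Lp : Nontrivial (Lp ℂ 2 μQ) := by
  obtain ⟨t, ht, -, h0, hlt⟩ := Measure.exists_subset_measure_lt_top (μ := μQ) MeasurableSet.univ
    (pos_iff_ne_zero.2 (NeZero.ne _) : 0 < μQ univ)
  refine ⟨indicatorConstLp 2 ht hlt.ne 1, 0, fun h => ?_⟩
  have hn := congrArg norm h
  rw [norm_indicatorConstLp two_ne_zero ENNReal.ofNat_ne_top, norm_zero, norm_one, one_mul] at hn
  exact (Real.rpow_pos_of_pos (ENNReal.toReal_pos h0.ne' hlt.ne) _).ne' hn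

/-! ### The orthogonality relation and its consequences. -/

variable (V) in
/-- The function `q ↦ |q| Δ_Q(q)⁻¹`. -/
noncomputable def dufloMooreWeight (q : Q) : ℝ := (modulus V q : ℝ) * (modularFun q : ℝ)⁻¹

theorem dufloMooreWeight_pos (q : Q) : 0 < dufloMooreWeight V q := by
  rw [dufloMooreWeight, modularFun_inv]
  exact mul_pos (NNReal.coe_pos.2 (modulus_pos V q)) (NNReal.coe_pos.2 (modularCharacter_pos q))

variable (Q V) in
theorem measurable_dufloMooreWeight : Measurable (dufloMooreWeight V : Q → ℝ) := by
  unfold dufloMooreWeight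
  simp only [modularFun_inv]
  exact (measurable_modulus Q V).coe_nnreal_real.mul
    (measurable_modularCharacter Q).coe_nnreal_real

theorem ofReal_dufloMooreWeight (q : Q) : ENNReal.ofReal (dufloMooreWeight V q) =
    ((modulus V q : ℝ≥0) : ℝ≥0∞) * (Measure.modularCharacter q : ℝ≥0) := by
  rw [dufloMooreWeight, modularFun_inv, ← NNReal.coe_mul, ENNReal.ofReal_coe_nnreal,
    ENNReal.coe_mul]

variable [MeasurableSpace (Dual V)] [BorelSpace (Dual V)]
    {μV : Measure V} [μV.IsAddHaarMeasure] {μD : Measure (Dual V)}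

/-- Plancherel in `v` for a fixed `q`, followed by the substitution `q₀ = q s`. A product of two
`L²` functions is integrable but may fail to be in `L²`, so both sides may be infinite. -/
theorem IsCocycleRep.lintegral_inner_right (hπ : IsCocycleRep η b π)
    (hη : IsMeasureClassIso μQ μD η) (hμV : IsDualNormalized μV μD)
    (hμQ : IsCocycleNormalized η μQ μD)
    (hb : Measurable fun p : Q × Q => (b p.1 p.2 : ℂ)) (x y : Lp ℂ 2 μQ) (q : Q) :
    ∫⁻ v, ‖⟪x, π ⟨q, v⟩ y⟫_ℂ‖ₑ ^ 2 ∂μV =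
      ((modulus V q : ℝ≥0) : ℝ≥0∞) *
        ∫⁻ s, ((modulus V s : ℝ≥0) : ℝ≥0∞) * ‖y s‖ₑ ^ 2 * ‖x (q * s)‖ₑ ^ 2 ∂μQ := by
  have hF : Integrable (fun q₀ => (b q₀⁻¹ q : ℂ) * y (q⁻¹ * q₀) * (starRingEnd ℂ) (x q₀)) μQ := by
    have hxc : MemLp (fun q₀ => (starRingEnd ℂ) (x q₀)) 2 μQ :=
      (memLp_congr_norm (Lp.aestronglyMeasurable x)
        (Complex.continuous_conj.comp_aestronglyMeasurable (Lp.aestronglyMeasurable x))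
        (Filter.Eventually.of_forall fun q => (RCLike.norm_conj _).symm)).1 (Lp.memLp x)
    exact (memLp_weightedTranslation (u := fun q₀ => (b q₀⁻¹ q : ℂ))
      (hb.comp (measurable_inv.prodMk measurable_const)) (fun _ => Circle.norm_coe _) q⁻¹
      (Lp.memLp y)).integrable_mul hxc
  simp only [hπ.inner_eq]
  rw [lintegral_enorm_integral_pairing_cocycle_sq hη hμV hμQ hF,
    ← lintegral_mul_left_eq_self _ q]
  rw [← lintegral_const_mul' _ _ ENNReal.coe_ne_top]
  refine lintegral_congr fun s => ?_
  have hb1 : ‖(b (q * s)⁻¹ q : ℂ)‖ₑ = 1 := by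
    rw [← ofReal_norm, Circle.norm_coe, ENNReal.ofReal_one]
  rw [inv_mul_cancel_left, enorm_mul, enorm_mul, hb1, RCLike.enorm_conj, one_mul, mul_pow,
    modulus_mul, ENNReal.coe_mul]
  ring

/-- The orthogonality relation for the representation `π`. -/
theorem IsCocycleRep.lintegral_inner (hπ : IsCocycleRep η b π)
    (hη : IsMeasureClassIso μQ μD η) (hμV : IsDualNormalized μV μD)
    (hμQ : IsCocycleNormalized η μQ μD)
    (hb : Measurable fun p : Q × Q => (b p.1 p.2 : ℂ)) (x y : Lp ℂ 2 μQ) :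
    ∫⁻ g, ‖⟪x, π g y⟫_ℂ‖ₑ ^ 2 ∂extensionHaar β μQ μV =
      ‖x‖ₑ ^ 2 * ∫⁻ q, ENNReal.ofReal (dufloMooreWeight V q) * ‖y q‖ₑ ^ 2 ∂μQ := by
  have hx : Measurable x := (Lp.stronglyMeasurable x).measurable
  have hy : Measurable y := (Lp.stronglyMeasurable y).measurable
  have hm : Measurable fun g => ‖⟪x, π g y⟫_ℂ‖ₑ ^ 2 :=
    (hπ.measurable_inner hb x y).enorm.pow_const 2
  have hmod := (measurable_modulus Q V).coe_nnreal_ennreal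
  have hx2 : Measurable fun q => ‖x q‖ₑ ^ 2 := hx.enorm.pow_const 2
  have hy2 : Measurable fun q => ((modulus V q : ℝ≥0) : ℝ≥0∞) * ‖y q‖ₑ ^ 2 :=
    hmod.mul (hy.enorm.pow_const 2)
  have hprod : Measurable fun p : Q × Q =>
      ((modulus V p.2 : ℝ≥0) : ℝ≥0∞) * ‖y p.2‖ₑ ^ 2 * ‖x (p.1 * p.2)‖ₑ ^ 2 :=
    (hy2.comp measurable_snd).mul (hx2.comp (measurable_fst.mul measurable_snd))
  have hweighted : Measurable fun q => ((modulus V q : ℝ≥0) : ℝ≥0∞) *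
      ∫⁻ s, ((modulus V s : ℝ≥0) : ℝ≥0∞) * ‖y s‖ₑ ^ 2 * ‖x (q * s)‖ₑ ^ 2 ∂μQ :=
    hmod.mul (hprod.lintegral_prod_right' (ν := μQ))
  have hm' : AEMeasurable (fun p : Q × V => ‖⟪x, π ⟨p.1, p.2⟩ y⟫_ℂ‖ₑ ^ 2)
      ((modulusMeasure V μQ).prod μV) := (hm.comp Extension.measurable_mk).aemeasurable
  change ∫⁻ g, ‖⟪x, π g y⟫_ℂ‖ₑ ^ 2 ∂(((modulusMeasure V μQ).prod μV).map _) = _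
  rw [lintegral_map hm Extension.measurable_mk, lintegral_prod _ hm']
  simp only [hπ.lintegral_inner_right hη hμV hμQ hb]
  rw [modulusMeasure, lintegral_withDensity_eq_lintegral_mul _ (measurable_modulus_inv V)
    hweighted]
  simp only [Pi.mul_apply]
  have hcancel : ∀ (q : Q) (t : ℝ≥0∞), ((modulus V q : ℝ≥0) : ℝ≥0∞)⁻¹ *
      (((modulus V q : ℝ≥0) : ℝ≥0∞) * t) = t := fun q t =>
    ENNReal.inv_mul_cancel_left (coe_modulus_ne_zero q) ENNReal.coe_ne_top
  simp only [hcancel]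
  -- After Tonelli the inner integral is a right translate of `|x|²`, which contributes the modular
  -- factor.
  rw [lintegral_lintegral_swap hprod.aemeasurable, enorm_sq_eq_lintegral, mul_comm,
    ← lintegral_mul_const' _ _ (lintegral_enorm_sq_lt_top x).ne]
  refine lintegral_congr fun s => ?_
  have hxs : Measurable fun q => ‖x (q * s)‖ₑ ^ 2 := hx2.comp (measurable_mul_const s)
  rw [lintegral_const_mul _ hxs,
    lintegral_mul_right_eq_modularCharacter μQ hx2 s, ofReal_dufloMooreWeight]
  ring

/-- If `x` is orthogonal to an invariant subspace containing `y ≠ 0`, the orthogonality relation has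
left side zero; the weight is strictly positive, so the factor depending on `y` is not zero and `x =
0`. -/
theorem IsCocycleRep.isIrreducible (hπ : IsCocycleRep η b π)
    (hη : IsMeasureClassIso μQ μD η) (hμV : IsDualNormalized μV μD)
    (hμQ : IsCocycleNormalized η μQ μD)
    (hb : Measurable fun p : Q × Q => (b p.1 p.2 : ℂ)) : IsIrreducible π := by
  refine ⟨nontrivial_Lp, fun W hW hinv => or_iff_not_imp_left.2 fun hne => ?_⟩
  obtain ⟨y, hyW, hy⟩ := Submodule.exists_mem_ne_zero_of_ne_bot hne
  haveI : CompleteSpace W := hW.completeSpace_coe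
  rw [← Submodule.orthogonal_eq_bot_iff, Submodule.eq_bot_iff]
  intro x hx
  have h := hπ.lintegral_inner hη hμV hμQ hb x y
  have h0 : ∀ g, ‖⟪x, π g y⟫_ℂ‖ₑ ^ 2 = 0 := fun g => by
    rw [Submodule.inner_left_of_mem_orthogonal (hinv g y hyW) hx]
    simp
  simp only [h0, lintegral_zero] at h
  rcases mul_eq_zero.1 h.symm with h1 | h1
  · simpa using h1
  · refine absurd (Lp.ext ?_) hy
    have hm : Measurable fun q => ENNReal.ofReal (dufloMooreWeight V q) * ‖y q‖ₑ ^ 2 :=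
      (measurable_dufloMooreWeight Q V).ennreal_ofReal.mul
        ((Lp.stronglyMeasurable y).measurable.enorm.pow_const 2)
    rw [lintegral_eq_zero_iff hm] at h1
    filter_upwards [h1, Lp.coeFn_zero ℂ 2 μQ] with q hq hz
    have hpos := ENNReal.ofReal_pos.2 (dufloMooreWeight_pos (V := V) q)
    rw [hz]
    simpa [hpos.ne'] using (mul_eq_zero.1 hq).resolve_left hpos.ne'

theorem IsCocycleRep.isSquareIntegrable (hπ : IsCocycleRep η b π)
    (hη : IsMeasureClassIso μQ μD η) (hμV : IsDualNormalized μV μD)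
    (hμQ : IsCocycleNormalized η μQ μD)
    (hb : Measurable fun p : Q × Q => (b p.1 p.2 : ℂ)) :
    IsSquareIntegrable (extensionHaar β μQ μV) π := by
  haveI := nontrivial_Lp (μQ := μQ)
  have hd := dense_mulDomain (μ := μQ) (measurable_dufloMooreWeight Q V).sqrt
  obtain ⟨y, hy, hyd⟩ := hd.inter_open_nonempty {0}ᶜ isOpen_compl_singleton
    (exists_ne (0 : Lp ℂ 2 μQ))
  refine ⟨y, y, hy, hy, ?_⟩
  rw [hπ.lintegral_inner hη hμV hμQ hb,
    ← form_mulOp_sqrt (measurable_dufloMooreWeight Q V) fun q => (dufloMooreWeight_pos q).le,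
    dif_pos (show y ∈ (mulOp μQ fun q => √(dufloMooreWeight V q)).domain from hyd)]
  exact ENNReal.mul_lt_top (ENNReal.pow_lt_top enorm_lt_top) (ENNReal.pow_lt_top enorm_lt_top)

theorem IsCocycleRep.isDufloMoore_iff (hπ : IsCocycleRep η b π)
    (hη : IsMeasureClassIso μQ μD η) (hμV : IsDualNormalized μV μD)
    (hμQ : IsCocycleNormalized η μQ μD)
    (hb : Measurable fun p : Q × Q => (b p.1 p.2 : ℂ)) (D : Lp ℂ 2 μQ →ₗ.[ℂ] Lp ℂ 2 μQ) :
    IsDufloMoore (extensionHaar β μQ μV) π D ↔ D = mulOp μQ (dufloMooreWeight V) := by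
  have hm := measurable_dufloMooreWeight Q V
  have h0 : ∀ q : Q, 0 ≤ dufloMooreWeight V q := fun q => (dufloMooreWeight_pos q).le
  have hsqrt := isPositiveSqrt_mulOp (μ := μQ) hm h0
  constructor
  · rintro ⟨-, -, R, hR, hRD⟩
    haveI := nontrivial_Lp (μQ := μQ)
    obtain ⟨x, hx⟩ := exists_ne (0 : Lp ℂ 2 μQ)
    refine hR.eq_of_form_eq hsqrt fun y => ?_
    rw [form_mulOp_sqrt hm h0]
    have h := hRD x y
    rw [hπ.lintegral_inner hη hμV hμQ hb] at h
    -- One vector `x ≠ 0` suffices: `‖x‖²` is finite and nonzero, so it cancels even when the forms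
    -- are infinite.
    exact ((ENNReal.mul_right_inj (pow_ne_zero 2 (enorm_ne_zero.2 hx))
      (ENNReal.pow_ne_top enorm_ne_top)).1 h).symm
  · rintro rfl
    refine ⟨isPositiveSelfAdjoint_mulOp hm h0, fun φ h => ?_, _, hsqrt, fun x y => ?_⟩
    · exact eq_zero_of_mulOp_eq_zero dufloMooreWeight_pos φ h
    · rw [form_mulOp_sqrt hm h0, hπ.lintegral_inner hη hμV hμQ hb]

end Rep

end CocycleRep

open CocycleRep in
theorem proposition2p1
    {Q V : Type*}
    [Group Q] [TopologicalSpace Q] [IsTopologicalGroup Q] [T2Space Q]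
    [SecondCountableTopology Q] [LocallyCompactSpace Q] [MeasurableSpace Q] [BorelSpace Q]
    [AddCommGroup V] [TopologicalSpace V] [IsTopologicalAddGroup V] [T2Space V]
    [SecondCountableTopology V] [LocallyCompactSpace V] [MeasurableSpace V] [BorelSpace V]
    [DistribMulAction Q V] [ContinuousSMul Q V]
    [MeasurableSpace (Dual V)] [BorelSpace (Dual V)]
    -- the Haar measures `dq`, `dv`, `dξ`
    (μQ : Measure Q) [μQ.IsHaarMeasure]
    (μV : Measure V) [μV.IsAddHaarMeasure]
    (μD : Measure (Dual V)) [μD.IsHaarMeasure]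
    (η : OneCocycle Q V) (β : TwoCocycle Q V)
    -- `η` is essentially bijective
    (hη : IsMeasureClassIso μQ μD η)
    -- the normalization of the Haar measures
    (hμV : IsDualNormalized μV μD)
    (hμQ : IsCocycleNormalized η μQ μD)
    -- compatibility of `η` and `β`: `ψ = ∂b` for a fixed Borel map `b`
    (b : Q → Q → Circle) (hb : Measurable fun p : Q × Q => (b p.1 p.2 : ℂ))
    (hψ : ∀ q₁ q₂ q₃ : Q, psi η β q₁ q₂ q₃ = coboundary b q₁ q₂ q₃) :
    ∃ π : Extension β → (Lp ℂ 2 μQ ≃ₗᵢ[ℂ] Lp ℂ 2 μQ),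
      (∀ (g : Extension β) (φ : Lp ℂ 2 μQ), ∀ᵐ q₀ ∂μQ,
        π g φ q₀ =
          (((pairing (η q₀) g.v)⁻¹ : Circle) : ℂ) * (b q₀⁻¹ g.q : ℂ) * φ (g.q⁻¹ * q₀)) ∧
      IsProjectiveRep (omega η b) π ∧
      IsIrreducible π ∧
      IsSquareIntegrable (extensionHaar β μQ μV) π ∧
      ∀ D : Lp ℂ 2 μQ →ₗ.[ℂ] Lp ℂ 2 μQ,
        IsDufloMoore (extensionHaar β μQ μV) π D ↔
          D = mulOp μQ (fun q => (modulus V q : ℝ) * (modularFun q : ℝ)⁻¹) := by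
  obtain ⟨π, hπ⟩ := exists_isCocycleRep (μQ := μQ) η β hb
  exact ⟨π, hπ, hπ.isProjectiveRep hb hψ, hπ.isIrreducible hη hμV hμQ hb,
    hπ.isSquareIntegrable hη hμV hμQ hb, hπ.isDufloMoore_iff hη hμV hμQ hb⟩
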